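/- Let $T=\mathbb R^2/\mathbb Z^2$ be the closed torus with a fixed orientation, let $\hat\pi$ be the set of free homotopy classes of loops on $T$, and let $\mathbb Z\hat\pi$ be the free $\mathbb Z$-module with basis $\hat\pi$. The Goldman bracket is the bilinear map $[-,-]:\mathbb Z\hat\pi\times\mathbb Z\hat\pi\to\mathbb Z\hat\pi$ such that, for all smooth loops $\alpha,\beta$ on $T$ that intersect only in transverse double points, $$[\alpha,\beta]=\sum_{p\in\alpha\cap\beta}\epsilon(p)\,\alpha *_p\beta ,$$ where $\epsilon(p)=1$ if the tangent vectors to $\alpha$ and $\beta$ at $p$, in this order, match the orientation of $T$ and $\epsilon(p)=-1$ otherwise, and where $\alpha *_p\beta$ is the free homotopy class of the loop that starts at $p$, follows $\alpha$ once around and then $\beta$ once around. Then there is exactly one such bilinear map, and it makes $\mathbb Z\hat\pi$ a Lie algebra $\mathfrak G$ over $\mathbb Z$ (the Goldman Lie algebra of the torus). This Lie algebra is not nilpotent. Moreover, its lower central series $G_0=\mathfrak G$, $G_{i}=[\mathfrak G,G_{i-1}]$ stabilizes at a nonzero ideal: there is an ideal $I\neq 0$ of $\mathfrak G$ such that $G_i=I$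 for all $i\geq 1$. -/

import Mathlib

open scoped ContDiff

noncomputable section

namespace TorusGoldman

/-- The closed torus `ℝ² / ℤ²`. -/
abbrev Torus := UnitAddTorus (Fin 2)

/-- The plane `ℝ²`: the universal cover of the torus, and also the tangent space of the torus at
each of its points (through the covering projection). -/
abbrev Plane := Fin 2 → ℝ

/-- The covering projection `ℝ² → ℝ² / ℤ²`. -/
def proj (x : Plane) : Torus := fun i => (x i : UnitAddCircle)

/-- Continuous loops on the torus, parametrised by the circle `ℝ / ℤ`. -/
abbrev Loop := C(UnitAddCircle, Torus)

/-- Free homotopy (no base point) of loops on the torus. -/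
def freeHomotopy : Setoid Loop := ⟨ContinuousMap.Homotopic, ContinuousMap.Homotopic.equivalence⟩

/-- The set of free homotopy classes of loops on the torus. -/
def FreeClass : Type := Quotient freeHomotopy

/-- The free homotopy class of a loop. -/
def freeClass (γ : Loop) : FreeClass := Quotient.mk freeHomotopy γ

/-- The free `ℤ`-module with basis the set of free homotopy classes of loops. -/
abbrev LoopModule := FreeClass →₀ ℤ

/-- `f : ℝ → ℝ²` is a smooth lift of the loop `γ` to the universal covers. -/
def IsSmoothLift (γ : Loop) (f : ℝ → Plane) : Prop :=
  ContDiff ℝ ∞ f ∧ ∀ t : ℝ, γ (t : UnitAddCircle) = proj (f t)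

/-- A smooth loop on the torus. As the covering projections `ℝ → ℝ / ℤ` and `ℝ² → ℝ² / ℤ²` are
local diffeomorphisms, a loop is smooth iff it has a smooth lift. -/
structure SmoothLoop where
  loop : Loop
  smooth : ∃ f : ℝ → Plane, IsSmoothLift loop f

/-- The tangent vector of a smooth loop at a parameter `x ∈ ℝ / ℤ`: the derivative of a lift at
the representative of `x` in `[0, 1)`. (Two lifts differ by an element of `ℤ²`, so neither the lift
nor the representative matters.) -/
def SmoothLoop.velocity (γ : SmoothLoop) (x : UnitAddCircle) : Plane :=
  deriv γ.smooth.choose (AddCircle.equivIco (1 : ℝ) 0 x : ℝ)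

/-- The intersection points of `α` and `β`, each given by its parameters on the two loops. -/
def crossings (α β : SmoothLoop) : Set (UnitAddCircle × UnitAddCircle) :=
  {p | α.loop p.1 = β.loop p.2}

/-- `α` and `β` intersect in transverse double points only: at each intersection point the two
tangent vectors are linearly independent, and each of the loops passes through the point once. -/
structure TransverseDoublePoints (α β : SmoothLoop) : Prop where
  transverse : ∀ p ∈ crossings α β, LinearIndependent ℝ ![α.velocity p.1, β.velocity p.2]
  double_left : ∀ p ∈ crossings α β, ∀ s, α.loop s = α.loop p.1 → s = p.1
  double_right : ∀ p ∈ crossings α β, ∀ t, β.loop t = β.loop p.2 → t = p.2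

open Classical in
/-- The sign of an intersection point, where the torus is oriented by the orientation `o` of its
tangent plane: `1` if the tangent vectors to `α` and to `β`, in this order, form a basis that
matches the orientation, and `-1` otherwise. -/
def crossingSign (o : Orientation ℝ Plane (Fin 2)) (α β : SmoothLoop)
    (p : UnitAddCircle × UnitAddCircle) : ℤ :=
  if ∃ b : Module.Basis (Fin 2) ℝ Plane,
      b 0 = α.velocity p.1 ∧ b 1 = β.velocity p.2 ∧ b.orientation = o then 1 else -1

/-- The loop `γ`, traversed once starting at the parameter `s`, as a closed path. -/
def basedPath (γ : Loop) (s : UnitAddCircle) : Path (γ s) (γ s) where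
  toFun x := γ (s + ((x : ℝ) : UnitAddCircle))
  continuous_toFun := by
    have h : Continuous fun x : unitInterval => ((x : ℝ) : UnitAddCircle) :=
      (AddCircle.continuous_mk' (1 : ℝ)).comp continuous_subtype_val
    fun_prop
  source' := by simp
  target' := by
    have h : ((1 : ℝ) : UnitAddCircle) = 0 := AddCircle.coe_period 1
    simp [h]

/-- The loop on `ℝ / ℤ` that a closed path defines. -/
def loopOfPath {x : Torus} (c : Path x x) : Loop where
  toFun := AddCircle.liftIco (1 : ℝ) 0 c.extend
  continuous_toFun :=
    AddCircle.liftIco_zero_continuous (by simp) c.continuous_extend.continuousOn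

/-- The product `α *_p β` of two loops at an intersection point `p = α s = β t`: follow `α` once
around from `p`, and then `β` once around from `p`. -/
def loopProduct (α β : Loop) {s t : UnitAddCircle} (h : α s = β t) : Loop :=
  loopOfPath ((basedPath α s).trans ((basedPath β t).cast h h))

/-- The sum of `ε(p) (α *_p β)` over the intersection points `p` of `α` and `β`. (There are only
finitely many if all are transverse, as the torus is compact.) -/
def goldmanSum (o : Orientation ℝ Plane (Fin 2)) (α β : SmoothLoop) : LoopModule :=
  ∑ᶠ p : crossings α β,
    Finsupp.single (freeClass (loopProduct α.loop β.loop p.2)) (crossingSign o α β p.1)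

/-- The bilinear map `B` on the free module on the free homotopy classes is the Goldman bracket of
the torus with the orientation `o`: for any smooth loops that intersect in transverse double points,
the bracket of their classes is given by Goldman's formula. -/
def IsGoldmanBracket (o : Orientation ℝ Plane (Fin 2))
    (B : LoopModule →ₗ[ℤ] LoopModule →ₗ[ℤ] LoopModule) : Prop :=
  ∀ α β : SmoothLoop, TransverseDoublePoints α β →
    B (Finsupp.single (freeClass α.loop) 1) (Finsupp.single (freeClass β.loop) 1) = goldmanSum o α β

/-- The bilinear map `B` is a Lie bracket. -/
structure IsLieBracket {M : Type*} [AddCommGroup M] (B : M →ₗ[ℤ] M →ₗ[ℤ] M) : Prop where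
  self : ∀ x, B x x = 0
  jacobi : ∀ x y z, B x (B y z) + B y (B z x) + B z (B x y) = 0

theorem IsLieBracket.skew {M : Type*} [AddCommGroup M] {B : M →ₗ[ℤ] M →ₗ[ℤ] M}
    (h : IsLieBracket B) (x y : M) : B y x = -B x y := by
  have h1 := h.self (x + y)
  simp only [map_add, LinearMap.add_apply, h.self, zero_add, add_zero] at h1
  exact eq_neg_of_add_eq_zero_left h1

theorem IsLieBracket.leibniz {M : Type*} [AddCommGroup M] {B : M →ₗ[ℤ] M →ₗ[ℤ] M}
    (h : IsLieBracket B) (x y z : M) : B x (B y z) = B (B x y) z + B y (B x z) := by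
  have h1 := h.jacobi x y z
  rw [h.skew x z, map_neg, h.skew (B x y) z] at h1
  rw [← sub_eq_zero, ← h1]
  abel

/-- The additive group `M`, regarded as a Lie ring (that is, as a Lie algebra over `ℤ`) with the
bracket `B`. -/
def LieOf {M : Type*} [AddCommGroup M] {B : M →ₗ[ℤ] M →ₗ[ℤ] M} (_ : IsLieBracket B) := M

instance instAddCommGroupLieOf {M : Type*} [AddCommGroup M] {B : M →ₗ[ℤ] M →ₗ[ℤ] M} (h : IsLieBracket B) :
    AddCommGroup (LieOf h) := inferInstanceAs (AddCommGroup M)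

instance instLieRingLieOf {M : Type*} [AddCommGroup M] {B : M →ₗ[ℤ] M →ₗ[ℤ] M} (h : IsLieBracket B) :
    LieRing (LieOf h) where
  bracket x y := B x y
  add_lie x y z := (congrArg (fun f => f z) (map_add B x y) :)
  lie_add x y z := map_add (B x) y z
  lie_self x := h.self x
  leibniz_lie x y z := h.leibniz x y z

end TorusGoldman

end

noncomputable section

namespace TorusGoldman

/-! The covering ℝ² → T turns every question into one about vectors. A loop lifts to a curve `f`
with `f (t + 1) = f t + n`, and the winding vector `n ∈ ℤ²` classifies free homotopy classes
(`classEquiv`): homotopies lift, and loops with the same `n` are joined by straight segments between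
lifts.

If `α`, `β` have winding vectors `a`, `b`, every product `α *_p β` has winding vector `a + b`. So
Goldman's sum is a multiple of one basis element, and the multiple is the algebraic intersection
number, which must be shown to be ± det(a, b) (`goldmanSum_eq`). This is the degree of the map (s,
t) ↦ f s - g t between tori, up to sign. It is computed by integrating `φ (f s - g t) * det (f' s,
g' t)` over a period square. For a nontrivial character `φ` the integral vanishes, for `φ = 1` it is
det(a, b), and density of trigonometric polynomials gives det(a, b) ∫ φ for all continuous `φ`
(`integral_crossing`). Taking for `φ` a small tent at 0 localises the integral at the crossings,
where the change of variables formula yields the signs (`exists_local_crossing`,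
`exists_sum_isign_eq`).

A bilinear map satisfying Goldman's formula is therefore forced on each pair of classes that has
transverse representatives. Every pair has them (`exists_transverse`): disjoint parallel curves if
det(a, b) = 0, and otherwise straight curves with a small sinusoidal perturbation, which is needed
because a straight loop with non-primitive winding vector retraces itself.

What remains is algebra with [a, b] = ± det(a, b) (a + b). The Jacobi identity is a polynomial
identity. For c = a + b ≠ 0 write c = d p with p primitive and choose e with det(e, p) = 1. Then e
lies in G₁, so d c lies in G₂, and [a, b] is an integer multiple of d c because det(a, b) = det(a,
c) = d det(a, p). Hence G₁ ⊆ G₂ (`lowerCentralSeries_one_le_two`), the series is constant from G₁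
on, and G₁ ≠ 0. -/

/-! ### Lifts, winding vectors and free homotopy classes -/

/-- The lattice `ℤ²`, as vectors of the plane. -/
def lat (n : Fin 2 → ℤ) : Plane := fun i => (n i : ℝ)

theorem lat_add (m n : Fin 2 → ℤ) : lat (m + n) = lat m + lat n := by
  ext i; simp [lat]

theorem lat_injective : Function.Injective lat := fun m n h => by
  ext i; simpa [lat] using congrFun h i

theorem proj_add (x y : Plane) : proj (x + y) = proj x + proj y := by
  ext i; simp [proj]

theorem proj_sub (x y : Plane) : proj (x - y) = proj x - proj y := by
  ext i; simp [proj]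

theorem proj_eq_zero_iff {x : Plane} : proj x = 0 ↔ ∃ n, x = lat n := by
  constructor
  · intro h
    have h' : ∀ i, ∃ n : ℤ, n • (1 : ℝ) = x i := fun i =>
      (AddCircle.coe_eq_zero_iff 1).1 (congrFun h i)
    choose n hn using h'
    exact ⟨n, funext fun i => by simp [lat, ← hn]⟩
  · rintro ⟨n, rfl⟩
    ext i
    exact (AddCircle.coe_eq_zero_iff 1).2 ⟨n i, by simp [lat]⟩

@[simp] theorem proj_lat (n : Fin 2 → ℤ) : proj (lat n) = 0 := proj_eq_zero_iff.2 ⟨n, rfl⟩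

theorem proj_eq_proj_iff {x y : Plane} : proj x = proj y ↔ ∃ n, x - y = lat n := by
  rw [← proj_eq_zero_iff, proj_sub, sub_eq_zero]

theorem continuous_proj : Continuous proj :=
  continuous_pi fun i => (AddCircle.continuous_mk' (1 : ℝ)).comp (continuous_apply i)

/-- Two maps into the plane with the same projection to the torus that agree at a point of a
preconnected set agree on the set. -/
theorem eqOn_of_proj_eqOn {A : Type*} [TopologicalSpace A] {S : Set A} (hS : IsPreconnected S)
    {f g : A → Plane} (hf : ContinuousOn f S) (hg : ContinuousOn g S)
    (h : ∀ x ∈ S, proj (f x) = proj (g x)) {a : A} (ha : a ∈ S) (hfg : f a = g a) :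
    Set.EqOn f g S := by
  intro x hx
  ext i
  exact (AddCircle.isCoveringMap_coe (1 : ℝ)).eqOn_of_comp_eqOn hS
    (g₁ := fun x => f x i) (g₂ := fun x => g x i)
    ((continuous_apply i).comp_continuousOn hf) ((continuous_apply i).comp_continuousOn hg)
    (fun y hy => congrFun (h y hy) i) ha (congrFun hfg i) hx

/-- A lift of a loop on the torus to the plane, with the translation by which it is equivariant. -/
structure IsLift (γ : Loop) (f : ℝ → Plane) (n : Fin 2 → ℤ) : Prop where
  continuous : Continuous f
  lifts : ∀ t : ℝ, γ (t : UnitAddCircle) = proj (f t)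
  add_one : ∀ t, f (t + 1) = f t + lat n

/-- The loop `γ` has winding vector `n`. -/
def HasWinding (γ : Loop) (n : Fin 2 → ℤ) : Prop := ∃ f, IsLift γ f n

/-- The displacement `f (t + 1) - f t` is continuous and lattice-valued, hence constant. -/
theorem exists_isLift {γ : Loop} {f : ℝ → Plane} (hf : Continuous f)
    (h : ∀ t : ℝ, γ (t : UnitAddCircle) = proj (f t)) : ∃ n, IsLift γ f n := by
  have h1 : ∀ t, proj (f (t + 1)) = proj (f t) := fun t => by
    rw [← h, ← h, AddCircle.coe_add_period]
  obtain ⟨n, hn⟩ := proj_eq_proj_iff.1 (h1 0)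
  refine ⟨n, hf, h, fun t => ?_⟩
  refine eqOn_of_proj_eqOn (S := Set.univ) isPreconnected_univ (f := fun t => f (t + 1))
    (g := fun t => f t + lat n) (by fun_prop) (by fun_prop) (fun t _ => ?_) (Set.mem_univ 0) ?_
    (Set.mem_univ t)
  · simp [proj_add, h1]
  · simp [← hn]

theorem exists_hasWinding (γ : Loop) : ∃ n, HasWinding γ n := by
  have key : ∀ i, ∃ F : C(ℝ, ℝ), ∀ t : ℝ, γ (t : UnitAddCircle) i = (F t : UnitAddCircle) := by
    intro i
    let G : C(ℝ, UnitAddCircle) := ⟨fun t => γ (t : UnitAddCircle) i,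
      (continuous_apply i).comp (γ.continuous.comp (AddCircle.continuous_mk' (1 : ℝ)))⟩
    obtain ⟨e, he⟩ := QuotientAddGroup.mk_surjective (G 0)
    obtain ⟨F, hF, -⟩ := (AddCircle.isCoveringMap_coe (1 : ℝ)).existsUnique_continuousMap_lifts
      G (a₀ := 0) (e₀ := e) he
    exact ⟨F, fun t => (congrFun hF.2 t).symm⟩
  choose F hF using key
  obtain ⟨n, hn⟩ := exists_isLift (γ := γ) (f := fun t i => F i t) (by fun_prop)
    (fun t => funext fun i => hF i t)
  exact ⟨n, _, hn⟩

/-- The winding vector is the displacement along any lift over one period. -/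
theorem HasWinding.eq_of_lift {γ : Loop} {n m : Fin 2 → ℤ} (h : HasWinding γ n) {φ : ℝ → Plane}
    (hφ : ContinuousOn φ (Set.Icc 0 1)) (hl : ∀ x ∈ Set.Icc (0 : ℝ) 1, γ (x : UnitAddCircle) = proj (φ x))
    (hm : φ 1 = φ 0 + lat m) : n = m := by
  obtain ⟨f, hf⟩ := h
  have h0 : (0 : ℝ) ∈ Set.Icc (0 : ℝ) 1 := by simp
  have h1 : (1 : ℝ) ∈ Set.Icc (0 : ℝ) 1 := by simp
  obtain ⟨k, hk⟩ := proj_eq_proj_iff.1 ((hl 0 h0).symm.trans (hf.lifts 0))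
  have := eqOn_of_proj_eqOn isPreconnected_Icc (f := φ) (g := fun t => f t + lat k) hφ
    (hf.continuous.add continuous_const).continuousOn
    (fun t ht => by simp [proj_add, ← hl t ht, ← hf.lifts t]) h0 (by simp [← hk]) h1
  have h3 := hf.add_one 0
  rw [zero_add] at h3
  apply lat_injective
  rw [hm] at this
  simp only [h3] at this
  have h4 : φ 0 = f 0 + lat k := by simp [← hk]
  rw [h4] at this
  have h5 : f 0 + lat k + lat m = f 0 + lat k + lat n := by rw [this]; abel
  exact (add_left_cancel h5).symm

theorem HasWinding.unique {γ : Loop} {n m : Fin 2 → ℤ} (hn : HasWinding γ n)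
    (hm : HasWinding γ m) : n = m := by
  obtain ⟨f, hf⟩ := hm
  exact hn.eq_of_lift hf.continuous.continuousOn (fun x _ => hf.lifts x)
    (by simpa using hf.add_one 0)

/-- The homotopy lifts, coordinate by coordinate, to one starting at the given lift. Its
displacement over a period is lattice-valued and continuous in the homotopy parameter, so it stays
equal to `n`. -/
theorem HasWinding.of_homotopic {γ δ : Loop} (h : γ.Homotopic δ) {n : Fin 2 → ℤ}
    (hn : HasWinding γ n) : HasWinding δ n := by
  obtain ⟨H⟩ := h
  obtain ⟨f, hf⟩ := hn
  have key : ∀ i, ∃ F : C(unitInterval × ℝ, ℝ), (∀ u (t : ℝ), H (u, (t : UnitAddCircle)) i = (F (u, t) : UnitAddCircle))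
      ∧ ∀ t, F (0, t) = f t i := by
    intro i
    let G : C(unitInterval × ℝ, UnitAddCircle) := ⟨fun p => H (p.1, (p.2 : UnitAddCircle)) i,
      (continuous_apply i).comp (H.continuous.comp (continuous_fst.prodMk
        ((AddCircle.continuous_mk' (1 : ℝ)).comp continuous_snd)))⟩
    let f' : C(ℝ, ℝ) := ⟨fun t => f t i, (continuous_apply i).comp hf.continuous⟩
    have h0 : ∀ t, G (0, t) = (f' t : UnitAddCircle) := fun t => by
      change H (0, (t : UnitAddCircle)) i = _
      rw [H.apply_zero, hf.lifts]; rfl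
    refine ⟨(AddCircle.isCoveringMap_coe (1 : ℝ)).liftHomotopy G f' h0, fun u t => ?_, fun t => ?_⟩
    · exact (congrFun ((AddCircle.isCoveringMap_coe (1 : ℝ)).liftHomotopy_lifts G f' h0) (u, t)).symm
    · exact (AddCircle.isCoveringMap_coe (1 : ℝ)).liftHomotopy_zero G f' h0 t
  choose F hF hF0 using key
  have hF' : ∀ u (t : ℝ), H (u, (t : UnitAddCircle)) = proj (fun i => F i (u, t)) := fun u t =>
    funext fun i => hF i u t
  refine ⟨fun t i => F i (1, t), by fun_prop, fun t => ?_, fun t => ?_⟩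
  · rw [← hF', H.apply_one]
  · refine eqOn_of_proj_eqOn (S := Set.univ) isPreconnected_univ
      (f := fun u : unitInterval => (fun i => F i (u, t + 1) : Plane))
      (g := fun u => (fun i => F i (u, t)) + lat n) (by fun_prop) (by fun_prop) (fun u _ => ?_)
      (Set.mem_univ 0) ?_ (Set.mem_univ 1)
    · simp only [proj_add, ← hF', proj_lat, add_zero]
      rw [AddCircle.coe_add_period]
    · ext i
      simp [hF0, hf.add_one]

/-- The difference of two lifts with equal displacement is periodic, so it descends to the circle
and can be scaled from 0 to 1. -/
theorem HasWinding.homotopic {γ δ : Loop} {n : Fin 2 → ℤ} (hγ : HasWinding γ n)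
    (hδ : HasWinding δ n) : γ.Homotopic δ := by
  obtain ⟨f, hf⟩ := hγ
  obtain ⟨g, hg⟩ := hδ
  have hper : Function.Periodic (fun t => g t - f t) 1 := fun t => by
    simp [hf.add_one, hg.add_one]
  have hc : Continuous hper.lift :=
    continuous_quot_lift _ (hg.continuous.sub hf.continuous)
  let H : C(unitInterval × UnitAddCircle, Torus) :=
    ⟨fun p => γ p.2 + proj ((p.1 : ℝ) • hper.lift p.2),
      (γ.continuous.comp continuous_snd).add (continuous_proj.comp
        ((continuous_subtype_val.comp continuous_fst).smul (hc.comp continuous_snd)))⟩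
  refine ⟨⟨H, fun x => ?_, fun x => ?_⟩⟩
  · change γ x + proj (((0 : unitInterval) : ℝ) • hper.lift x) = γ x
    have : proj 0 = 0 := proj_eq_zero_iff.2 ⟨0, by ext; simp [lat]⟩
    simp [this]
  · change γ x + proj (((1 : unitInterval) : ℝ) • hper.lift x) = δ x
    obtain ⟨t, rfl⟩ := QuotientAddGroup.mk_surjective x
    have h1 : hper.lift ((t : ℝ) : UnitAddCircle) = g t - f t := hper.lift_coe t
    have h2 := hf.lifts t
    have h3 := hg.lifts t
    change γ (t : UnitAddCircle) + proj (((1 : unitInterval) : ℝ) • hper.lift (t : UnitAddCircle)) = δ (t : UnitAddCircle)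
    rw [h1, h2, h3]
    simp [proj_sub]

theorem hasWinding_line (n : Fin 2 → ℤ) : ∃ γ : Loop, HasWinding γ n := by
  refine ⟨⟨fun x i => n i • x, by fun_prop⟩, fun t i => n i * t, by fun_prop, fun t => ?_,
    fun t => ?_⟩
  · ext i
    simp [proj]
  · ext i
    simp [lat]; ring

/-- The winding vector of a loop. -/
def winding (γ : Loop) : Fin 2 → ℤ := (exists_hasWinding γ).choose

theorem hasWinding_winding (γ : Loop) : HasWinding γ (winding γ) := (exists_hasWinding γ).choose_spec

theorem HasWinding.winding_eq {γ : Loop} {n : Fin 2 → ℤ} (h : HasWinding γ n) : winding γ = n :=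
  (hasWinding_winding γ).unique h

theorem homotopic_iff_winding_eq {γ δ : Loop} : γ.Homotopic δ ↔ winding γ = winding δ :=
  ⟨fun h => ((hasWinding_winding γ).of_homotopic h).winding_eq.symm,
    fun h => (hasWinding_winding γ).homotopic (h ▸ hasWinding_winding δ)⟩

/-- Free homotopy classes of loops on the torus are classified by their winding vectors. -/
def classEquiv : FreeClass ≃ (Fin 2 → ℤ) :=
  Equiv.ofBijective (Quotient.lift winding fun _ _ h => homotopic_iff_winding_eq.1 h) <| by
    constructor
    · rintro ⟨γ⟩ ⟨δ⟩ h
      exact Quotient.sound (homotopic_iff_winding_eq.2 h)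
    · intro n
      obtain ⟨γ, hγ⟩ := hasWinding_line n
      exact ⟨freeClass γ, hγ.winding_eq⟩

theorem classEquiv_freeClass (γ : Loop) : classEquiv (freeClass γ) = winding γ := rfl

theorem loopOfPath_coe {x : Torus} (c : Path x x) {t : ℝ} (ht : t ∈ Set.Icc (0 : ℝ) 1) :
    loopOfPath c (t : UnitAddCircle) = c.extend t := by
  have key : ∀ t ∈ Set.Ico (0 : ℝ) 1, loopOfPath c (t : UnitAddCircle) = c.extend t := fun t ht =>
    AddCircle.liftIco_zero_coe_apply (p := (1 : ℝ)) (f := (c.extend : ℝ → Torus)) ht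
  rcases ht.2.lt_or_eq with h | rfl
  · exact key t ⟨ht.1, h⟩
  · rw [AddCircle.coe_period, ← AddCircle.coe_zero, key 0 (by simp)]
    simp

theorem HasWinding.loopProduct {α β : Loop} {a b : Fin 2 → ℤ} (hα : HasWinding α a)
    (hβ : HasWinding β b) {s t : UnitAddCircle} (h : α s = β t) :
    HasWinding (loopProduct α β h) (a + b) := by
  obtain ⟨f, hf⟩ := hα
  obtain ⟨g, hg⟩ := hβ
  obtain ⟨s, rfl⟩ := QuotientAddGroup.mk_surjective s
  obtain ⟨t, rfl⟩ := QuotientAddGroup.mk_surjective t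
  have hs := hf.lifts s
  have ht := hg.lifts t
  have hst : proj (f s) = proj (g t) := by rw [← hs, ← ht]; exact h
  set γ := TorusGoldman.loopProduct α β h with hγ
  -- A lift of the product: one period of `f` from `s`, then one period of `g` from `t`, translated
  -- to start where the first half ends. The translation is a lattice vector because `f s` and `g t`
  -- lie over the same point.
  let φ : ℝ → Plane := fun x => if x ≤ 1 / 2 then f (s + 2 * x)
    else g (t + (2 * x - 1)) + (f (s + 1) - g t)
  have hφ : Continuous φ := by
    refine Continuous.if_le (by have := hf.continuous; fun_prop) (by have := hg.continuous; fun_prop)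
      continuous_id continuous_const fun x hx => ?_
    subst hx
    norm_num
  have key : winding γ = a + b := by
    refine (hasWinding_winding γ).eq_of_lift hφ.continuousOn (fun x hx => ?_) ?_
    · rw [hγ]
      change loopOfPath _ _ = _
      rw [loopOfPath_coe _ hx, Path.extend_apply _ hx, Path.trans_apply]
      simp only [φ]
      split_ifs with hx2
      · rw [← hf.lifts]
        rfl
      · rw [proj_add, ← hg.lifts, hf.add_one, proj_sub, proj_add, hst, proj_lat]
        simp
        rfl
    · have h1 := hf.add_one s
      have h2 := hg.add_one t
      norm_num [φ, h1, h2, lat_add]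
      abel
  rw [← key]
  exact hasWinding_winding γ

/-! ### The global degree formula, by Fourier analysis -/

/-- The determinant of two vectors of the plane. -/
def wedge (u v : Plane) : ℝ := u 0 * v 1 - u 1 * v 0

/-- The determinant of two integral vectors. -/
def idet (a b : Fin 2 → ℤ) : ℤ := a 0 * b 1 - a 1 * b 0

theorem wedge_lat (a b : Fin 2 → ℤ) : wedge (lat a) (lat b) = idet a b := by
  simp [wedge, idet, lat]

theorem continuous_deriv_apply {f : ℝ → Plane} (hf : ContDiff ℝ ∞ f) (i : Fin 2) :
    Continuous fun s => deriv f s i :=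
  (continuous_apply i).comp (hf.continuous_deriv (by simp))

theorem hasDerivAt_apply {f : ℝ → Plane} (hf : ContDiff ℝ ∞ f) (s : ℝ) (i : Fin 2) :
    HasDerivAt (fun s => f s i) (deriv f s i) s :=
  hasDerivAt_pi.1 (hf.differentiable (by simp) s).hasDerivAt i

theorem continuous_wedge_deriv {f g : ℝ → Plane} (hf : ContDiff ℝ ∞ f) (hg : ContDiff ℝ ∞ g) :
    Continuous fun p : ℝ × ℝ => wedge (deriv f p.1) (deriv g p.2) := by
  have h1 := fun i => (continuous_deriv_apply hf i).comp (continuous_fst (X := ℝ) (Y := ℝ))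
  have h2 := fun i => (continuous_deriv_apply hg i).comp (continuous_snd (X := ℝ) (Y := ℝ))
  exact ((h1 0).mul (h2 1)).sub ((h1 1).mul (h2 0))

theorem mFourier_proj (n : Fin 2 → ℤ) (x : Plane) :
    UnitAddTorus.mFourier n (proj x) =
      Complex.exp (2 * Real.pi * Complex.I * (n 0 * x 0 + n 1 * x 1)) := by
  change ∏ i, fourier (n i) ((x i : ℝ) : UnitAddCircle) = _
  simp only [Fin.prod_univ_two, fourier_coe_apply, ← Complex.exp_add]
  congr 1
  push_cast
  ring

/-- The density whose integral over a period square counts the values of `f s - g t`, weighted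
by `φ` and signed by orientation. -/
def crossingDensity (f g : ℝ → Plane) (φ : C(Torus, ℂ)) (s t : ℝ) : ℂ :=
  φ (proj (f s - g t)) * (wedge (deriv f s) (deriv g t) : ℂ)

/-- Continuity jointly with the weight `φ` makes the integral a continuous functional of `φ`, as the
density argument requires. -/
theorem continuous_crossingDensity {f g : ℝ → Plane} (hf : ContDiff ℝ ∞ f) (hg : ContDiff ℝ ∞ g) :
    Continuous fun p : (C(Torus, ℂ) × ℝ) × ℝ => crossingDensity f g p.1.1 p.1.2 p.2 := by
  have h1 : Continuous fun p : (C(Torus, ℂ) × ℝ) × ℝ => p.1.1 (proj (f p.1.2 - g p.2)) := by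
    have hfc := hf.continuous
    have hgc := hg.continuous
    have h2 : Continuous fun p : (C(Torus, ℂ) × ℝ) × ℝ => proj (f p.1.2 - g p.2) :=
      continuous_proj.comp (by fun_prop)
    exact ContinuousEval.continuous_eval.comp ((continuous_fst.comp continuous_fst).prodMk h2)
  have h3 : Continuous fun p : (C(Torus, ℂ) × ℝ) × ℝ => wedge (deriv f p.1.2) (deriv g p.2) :=
    (continuous_wedge_deriv hf hg).comp ((continuous_snd.comp continuous_fst).prodMk continuous_snd)
  exact h1.mul (Complex.continuous_ofReal.comp h3)

theorem continuous_inner_crossingDensity {f g : ℝ → Plane} (hf : ContDiff ℝ ∞ f)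
    (hg : ContDiff ℝ ∞ g) (t₀ t₁ : ℝ) :
    Continuous fun p : C(Torus, ℂ) × ℝ => ∫ t in t₀..t₁, crossingDensity f g p.1 p.2 t :=
  intervalIntegral.continuous_parametric_intervalIntegral_of_continuous'
    (f := fun (p : C(Torus, ℂ) × ℝ) t => crossingDensity f g p.1 p.2 t)
    (continuous_crossingDensity hf hg) t₀ t₁

/-- The integral of the crossing density over a period square, as a functional of `φ`. -/
def crossingIntegral {f g : ℝ → Plane} (hf : ContDiff ℝ ∞ f) (hg : ContDiff ℝ ∞ g) (s₀ t₀ : ℝ) :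
    C(Torus, ℂ) →ₗ[ℂ] ℂ where
  toFun φ := ∫ s in s₀..s₀ + 1, ∫ t in t₀..t₀ + 1, crossingDensity f g φ s t
  map_add' φ ψ := by
    have h1 : ∀ φ s, Continuous fun t => crossingDensity f g φ s t := fun φ s =>
      (continuous_crossingDensity hf hg).comp (by fun_prop : Continuous fun t : ℝ => ((φ, s), t))
    have h2 : ∀ φ, Continuous fun s => ∫ t in t₀..t₀ + 1, crossingDensity f g φ s t := fun φ =>
      (continuous_inner_crossingDensity hf hg t₀ (t₀ + 1)).comp
        (by fun_prop : Continuous fun s : ℝ => (φ, s))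
    rw [← intervalIntegral.integral_add ((h2 φ).intervalIntegrable _ _)
      ((h2 ψ).intervalIntegrable _ _)]
    congr 1
    ext s
    rw [← intervalIntegral.integral_add ((h1 φ s).intervalIntegrable _ _)
      ((h1 ψ s).intervalIntegrable _ _)]
    simp [crossingDensity, add_mul]
  map_smul' c φ := by
    simp [crossingDensity, mul_assoc]

theorem continuous_crossingIntegral {f g : ℝ → Plane} (hf : ContDiff ℝ ∞ f)
    (hg : ContDiff ℝ ∞ g) (s₀ t₀ : ℝ) : Continuous (crossingIntegral hf hg s₀ t₀) :=
  intervalIntegral.continuous_parametric_intervalIntegral_of_continuous'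
    (f := fun (φ : C(Torus, ℂ)) s => ∫ t in t₀..t₀ + 1, crossingDensity f g φ s t)
    (continuous_inner_crossingDensity hf hg t₀ (t₀ + 1)) s₀ (s₀ + 1)

/-- The Fourier coefficient of the velocity along a curve. -/
def velocityIntegral (f : ℝ → Plane) (n : Fin 2 → ℤ) (s₀ : ℝ) (i : Fin 2) : ℂ :=
  ∫ s in s₀..s₀ + 1, UnitAddTorus.mFourier n (proj (f s)) * (deriv f s i : ℂ)

theorem continuous_velocityIntegrand {f : ℝ → Plane} (hf : ContDiff ℝ ∞ f) (n : Fin 2 → ℤ)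
    (i : Fin 2) :
    Continuous fun s => UnitAddTorus.mFourier n (proj (f s)) * (deriv f s i : ℂ) :=
  ((UnitAddTorus.mFourier n).continuous.comp (continuous_proj.comp hf.continuous)).mul
    (Complex.continuous_ofReal.comp (continuous_deriv_apply hf i))

/-- Up to the factor 2πi, the left side integrates the derivative of the periodic function `mFourier
n (proj (f s))` over a period. -/
theorem dot_velocityIntegral {f : ℝ → Plane} (hf : ContDiff ℝ ∞ f) {a : Fin 2 → ℤ}
    (ha : ∀ t, f (t + 1) = f t + lat a) (n : Fin 2 → ℤ) (s₀ : ℝ) :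
    n 0 * velocityIntegral f n s₀ 0 + n 1 * velocityIntegral f n s₀ 1 = 0 := by
  have h2pi : (2 * Real.pi * Complex.I : ℂ) ≠ 0 := Complex.two_pi_I_ne_zero
  have hder : ∀ s, HasDerivAt (fun s => UnitAddTorus.mFourier n (proj (f s)))
      (2 * Real.pi * Complex.I * (n 0 * (UnitAddTorus.mFourier n (proj (f s)) * (deriv f s 0 : ℂ)) +
        n 1 * (UnitAddTorus.mFourier n (proj (f s)) * (deriv f s 1 : ℂ)))) s := fun s => by
    simp only [mFourier_proj]
    have h0 := (hasDerivAt_apply hf s 0).ofReal_comp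
    have h1 := (hasDerivAt_apply hf s 1).ofReal_comp
    convert (((h0.const_mul (n 0 : ℂ)).fun_add (h1.const_mul (n 1 : ℂ))).const_mul
      (2 * Real.pi * Complex.I)).cexp using 1
    ring
  have hc := fun i => continuous_velocityIntegrand hf n i
  have hint := intervalIntegral.integral_eq_sub_of_hasDerivAt (a := s₀) (b := s₀ + 1)
    (fun s _ => hder s) (by
      apply Continuous.intervalIntegrable
      exact continuous_const.mul ((continuous_const.mul (hc 0)).add (continuous_const.mul (hc 1))))
  have hi : ∀ i, IntervalIntegrable
      (fun s => n i * (UnitAddTorus.mFourier n (proj (f s)) * (deriv f s i : ℂ)))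
      MeasureTheory.volume s₀ (s₀ + 1) :=
    fun i => (continuous_const.mul (hc i)).intervalIntegrable _ _
  rw [ha, proj_add, proj_lat, add_zero, sub_self, intervalIntegral.integral_const_mul,
    intervalIntegral.integral_add (hi 0) (hi 1), intervalIntegral.integral_const_mul,
    intervalIntegral.integral_const_mul] at hint
  exact (mul_eq_zero.1 hint).resolve_left h2pi

theorem velocityIntegral_zero {f : ℝ → Plane} (hf : ContDiff ℝ ∞ f) {a : Fin 2 → ℤ}
    (ha : ∀ t, f (t + 1) = f t + lat a) (s₀ : ℝ) (i : Fin 2) :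
    velocityIntegral f 0 s₀ i = a i := by
  have h1 := intervalIntegral.integral_eq_sub_of_hasDerivAt (a := s₀) (b := s₀ + 1)
    (fun s _ => hasDerivAt_apply hf s i) ((continuous_deriv_apply hf i).intervalIntegrable _ _)
  simp only [velocityIntegral, UnitAddTorus.mFourier_zero, ContinuousMap.one_apply, one_mul]
  rw [intervalIntegral.integral_ofReal, h1, ha]
  simp [lat]

/-- A character turns the difference `f s - g t` into a product, so the double integral separates.
-/
theorem crossingIntegral_mFourier {f g : ℝ → Plane} (hf : ContDiff ℝ ∞ f) (hg : ContDiff ℝ ∞ g)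
    (s₀ t₀ : ℝ) (n : Fin 2 → ℤ) :
    crossingIntegral hf hg s₀ t₀ (UnitAddTorus.mFourier n) =
      velocityIntegral f n s₀ 0 * velocityIntegral g (-n) t₀ 1 -
        velocityIntegral f n s₀ 1 * velocityIntegral g (-n) t₀ 0 := by
  have hcf := fun i => continuous_velocityIntegrand hf n i
  have hcg := fun i => continuous_velocityIntegrand hg (-n) i
  have hd : ∀ s t, crossingDensity f g (UnitAddTorus.mFourier n) s t =
      (UnitAddTorus.mFourier n (proj (f s)) * (deriv f s 0 : ℂ)) *
        (UnitAddTorus.mFourier (-n) (proj (g t)) * (deriv g t 1 : ℂ)) -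
      (UnitAddTorus.mFourier n (proj (f s)) * (deriv f s 1 : ℂ)) *
        (UnitAddTorus.mFourier (-n) (proj (g t)) * (deriv g t 0 : ℂ)) := fun s t => by
    have : UnitAddTorus.mFourier n (proj (f s - g t)) =
        UnitAddTorus.mFourier n (proj (f s)) * UnitAddTorus.mFourier (-n) (proj (g t)) := by
      simp only [mFourier_proj, ← Complex.exp_add]
      congr 1
      simp
      ring
    rw [crossingDensity, this, wedge]
    push_cast
    ring
  change ∫ s in s₀..s₀ + 1, ∫ t in t₀..t₀ + 1, crossingDensity f g _ s t = _
  simp only [hd]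
  have hin : ∀ s, (∫ t in t₀..t₀ + 1,
      ((UnitAddTorus.mFourier n (proj (f s)) * (deriv f s 0 : ℂ)) *
        (UnitAddTorus.mFourier (-n) (proj (g t)) * (deriv g t 1 : ℂ)) -
      (UnitAddTorus.mFourier n (proj (f s)) * (deriv f s 1 : ℂ)) *
        (UnitAddTorus.mFourier (-n) (proj (g t)) * (deriv g t 0 : ℂ)))) =
      (UnitAddTorus.mFourier n (proj (f s)) * (deriv f s 0 : ℂ)) * velocityIntegral g (-n) t₀ 1 -
      (UnitAddTorus.mFourier n (proj (f s)) * (deriv f s 1 : ℂ)) * velocityIntegral g (-n) t₀ 0 := by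
    intro s
    have hi : ∀ (c : ℂ) i, IntervalIntegrable
        (fun t => c * (UnitAddTorus.mFourier (-n) (proj (g t)) * (deriv g t i : ℂ)))
        MeasureTheory.volume t₀ (t₀ + 1) :=
      fun c i => (continuous_const.mul (hcg i)).intervalIntegrable _ _
    rw [intervalIntegral.integral_sub (hi _ 1) (hi _ 0),
      intervalIntegral.integral_const_mul, intervalIntegral.integral_const_mul]
    rfl
  simp only [hin]
  have hi : ∀ (c : ℂ) i, IntervalIntegrable
      (fun s => UnitAddTorus.mFourier n (proj (f s)) * (deriv f s i : ℂ) * c)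
      MeasureTheory.volume s₀ (s₀ + 1) :=
    fun c i => ((hcf i).mul continuous_const).intervalIntegrable _ _
  rw [intervalIntegral.integral_sub (hi _ 0) (hi _ 1),
      intervalIntegral.integral_mul_const, intervalIntegral.integral_mul_const]
  rfl

theorem crossingIntegral_mFourier_zero {f g : ℝ → Plane} (hf : ContDiff ℝ ∞ f)
    (hg : ContDiff ℝ ∞ g) {a b : Fin 2 → ℤ} (ha : ∀ t, f (t + 1) = f t + lat a)
    (hb : ∀ t, g (t + 1) = g t + lat b) (s₀ t₀ : ℝ) :
    crossingIntegral hf hg s₀ t₀ (UnitAddTorus.mFourier 0) = idet a b := by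
  rw [crossingIntegral_mFourier, neg_zero]
  simp only [velocityIntegral_zero hf ha, velocityIntegral_zero hg hb]
  simp [idet]

/-- Both velocity coefficients are annihilated by the nonzero covector `n`, so they are parallel in
ℂ² and their determinant vanishes. -/
theorem crossingIntegral_mFourier_ne_zero {f g : ℝ → Plane} (hf : ContDiff ℝ ∞ f)
    (hg : ContDiff ℝ ∞ g) {a b : Fin 2 → ℤ} (ha : ∀ t, f (t + 1) = f t + lat a)
    (hb : ∀ t, g (t + 1) = g t + lat b) (s₀ t₀ : ℝ) {n : Fin 2 → ℤ} (hn : n ≠ 0) :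
    crossingIntegral hf hg s₀ t₀ (UnitAddTorus.mFourier n) = 0 := by
  rw [crossingIntegral_mFourier]
  have h1 := dot_velocityIntegral hf ha n s₀
  have h2 := dot_velocityIntegral hg hb (-n) t₀
  simp only [Pi.neg_apply, Int.cast_neg] at h2
  set U := velocityIntegral f n s₀
  set V := velocityIntegral g (-n) t₀
  by_cases h0 : n 0 = 0
  · have h3 : (n 1 : ℂ) ≠ 0 := by
      intro h
      exact hn (by ext i; fin_cases i <;> simp_all)
    apply mul_left_cancel₀ h3
    linear_combination (-U 0) * h2 - V 0 * h1
  · have h3 : (n 0 : ℂ) ≠ 0 := by exact_mod_cast h0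
    apply mul_left_cancel₀ h3
    linear_combination (U 1) * h2 + V 1 * h1

/-- The crossing integrals of two pairs of loops are proportional to the determinants of the
winding vectors. -/
theorem crossingIntegral_proportional {f g f' g' : ℝ → Plane} (hf : ContDiff ℝ ∞ f)
    (hg : ContDiff ℝ ∞ g) (hf' : ContDiff ℝ ∞ f') (hg' : ContDiff ℝ ∞ g')
    {a b a' b' : Fin 2 → ℤ} (ha : ∀ t, f (t + 1) = f t + lat a)
    (hb : ∀ t, g (t + 1) = g t + lat b) (ha' : ∀ t, f' (t + 1) = f' t + lat a')
    (hb' : ∀ t, g' (t + 1) = g' t + lat b') (s₀ t₀ s₀' t₀' : ℝ) (φ : C(Torus, ℂ)) :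
    (idet a' b' : ℂ) * crossingIntegral hf hg s₀ t₀ φ =
      idet a b * crossingIntegral hf' hg' s₀' t₀' φ := by
  -- The kernel of this functional is closed and contains every character, so it is everything.
  let M : C(Torus, ℂ) →ₗ[ℂ] ℂ := (idet a' b' : ℂ) • crossingIntegral hf hg s₀ t₀ -
    (idet a b : ℂ) • crossingIntegral hf' hg' s₀' t₀'
  have hM : Continuous M :=
    (continuous_const.mul (continuous_crossingIntegral hf hg s₀ t₀)).sub
      (continuous_const.mul (continuous_crossingIntegral hf' hg' s₀' t₀'))
  have hclosed : IsClosed (LinearMap.ker M : Set C(Torus, ℂ)) := isClosed_singleton.preimage hM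
  have hle : Submodule.span ℂ (Set.range (UnitAddTorus.mFourier (d := Fin 2))) ≤ LinearMap.ker M := by
    rw [Submodule.span_le]
    rintro _ ⟨n, rfl⟩
    change _ * _ - _ * _ = (0 : ℂ)
    by_cases hn : n = 0
    · subst hn
      rw [crossingIntegral_mFourier_zero hf hg ha hb, crossingIntegral_mFourier_zero hf' hg' ha' hb']
      ring
    · rw [crossingIntegral_mFourier_ne_zero hf hg ha hb _ _ hn,
        crossingIntegral_mFourier_ne_zero hf' hg' ha' hb' _ _ hn]
      ring
  have htop := Submodule.topologicalClosure_minimal _ hle hclosed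
  rw [UnitAddTorus.span_mFourier_closure_eq_top] at htop
  exact sub_eq_zero.1 (htop (Submodule.mem_top (x := φ)))

/-- The degree formula, with a real weight. -/
theorem integral_crossing {f g : ℝ → Plane} (hf : ContDiff ℝ ∞ f) (hg : ContDiff ℝ ∞ g)
    {a b : Fin 2 → ℤ} (ha : ∀ t, f (t + 1) = f t + lat a)
    (hb : ∀ t, g (t + 1) = g t + lat b) (s₀ t₀ : ℝ) (φ : C(Torus, ℝ)) :
    ∫ s in s₀..s₀ + 1, ∫ t in t₀..t₀ + 1,
        φ (proj (f s - g t)) * wedge (deriv f s) (deriv g t) =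
      idet a b * ∫ x in (-1 / 2 : ℝ)..1 / 2, ∫ y in (-1 / 2 : ℝ)..1 / 2, φ (proj ![x, y]) := by
  -- The model pair has `f' s - g' t = (s, t)`, so its crossing integral is minus the integral of
  -- `φ` over a unit square, and its winding vectors have determinant -1.
  let f' : ℝ → Plane := fun s => ![s, 0]
  let g' : ℝ → Plane := fun t => ![0, -t]
  have hf' : ContDiff ℝ ∞ f' := contDiff_pi.2 fun i => by
    fin_cases i <;> simp [f'] <;> fun_prop
  have hg' : ContDiff ℝ ∞ g' := contDiff_pi.2 fun i => by
    fin_cases i <;> simp [g'] <;> fun_prop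
  have ha' : ∀ t, f' (t + 1) = f' t + lat ![1, 0] := fun t => by
    ext i; fin_cases i <;> simp [f', lat]
  have hb' : ∀ t, g' (t + 1) = g' t + lat ![0, -1] := fun t => by
    ext i; fin_cases i <;> simp [g', lat]; ring
  have hdf : ∀ s, deriv f' s = ![1, 0] := fun s => by
    refine HasDerivAt.deriv (hasDerivAt_pi.2 fun i => ?_)
    fin_cases i
    · simpa [f'] using hasDerivAt_id' s
    · simpa [f'] using hasDerivAt_const s (0 : ℝ)
  have hdg : ∀ s, deriv g' s = ![0, -1] := fun s => by
    refine HasDerivAt.deriv (hasDerivAt_pi.2 fun i => ?_)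
    fin_cases i
    · simpa [g'] using hasDerivAt_const s (0 : ℝ)
    · simpa [g'] using (hasDerivAt_id' s).fun_neg
  let ψ : C(Torus, ℂ) := ⟨fun x => (φ x : ℂ), by fun_prop⟩
  have h := crossingIntegral_proportional hf hg hf' hg' ha hb ha' hb' s₀ t₀ (-1 / 2) (-1 / 2) ψ
  have h1 : crossingIntegral hf hg s₀ t₀ ψ = ((∫ s in s₀..s₀ + 1, ∫ t in t₀..t₀ + 1,
        φ (proj (f s - g t)) * wedge (deriv f s) (deriv g t) : ℝ) : ℂ) := by
    simp only [← intervalIntegral.integral_ofReal, Complex.ofReal_mul]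
    rfl
  have h2 : crossingIntegral hf' hg' (-1 / 2) (-1 / 2) ψ =
      ((-∫ x in (-1 / 2 : ℝ)..1 / 2, ∫ y in (-1 / 2 : ℝ)..1 / 2, φ (proj ![x, y]) : ℝ) : ℂ) := by
    have hd : ∀ s t, crossingDensity f' g' ψ s t = ((-φ (proj ![s, t]) : ℝ) : ℂ) := fun s t => by
      have : f' s - g' t = ![s, t] := by ext i; fin_cases i <;> simp [f', g']
      simp [crossingDensity, hdf, hdg, wedge, this, ψ]
    change ∫ s in (-1 / 2 : ℝ)..-1 / 2 + 1, ∫ t in (-1 / 2 : ℝ)..-1 / 2 + 1, _ = _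
    simp only [hd, intervalIntegral.integral_ofReal, intervalIntegral.integral_neg]
    norm_num
  rw [h1, h2] at h
  have h3 : idet ![1, 0] ![0, -1] = -1 := by simp [idet]
  rw [h3] at h
  have h4 := h
  norm_cast at h4
  push_cast at h4
  linarith

/-! ### Localisation at the crossings and the sum of signs -/

section LocalDegree

open MeasureTheory

/-- The covering projection, in terms of pairs of coordinates. -/
def projPair (p : ℝ × ℝ) : Torus := proj ![p.1, p.2]

theorem continuous_projPair : Continuous projPair :=
  continuous_proj.comp (by fun_prop)

theorem projPair_sub (p q : ℝ × ℝ) : projPair (p - q) = projPair p - projPair q := by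
  rw [projPair, projPair, projPair, ← proj_sub]
  congr 1
  ext i; fin_cases i <;> simp

theorem norm_projPair {p : ℝ × ℝ} (h : ‖p‖ ≤ 1 / 2) : ‖projPair p‖ = ‖p‖ := by
  have h' := (Prod.norm_def p).symm.trans_le h
  have h1 := (le_max_left _ _).trans h'
  have h2 := (le_max_right _ _).trans h'
  have key : ∀ x : ℝ, ‖x‖ ≤ 1 / 2 → ‖(x : UnitAddCircle)‖ = ‖x‖ := fun x hx =>
    (AddCircle.norm_coe_eq_abs_iff 1 one_ne_zero).2 (by simpa using hx)
  apply le_antisymm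
  · refine (pi_norm_le_iff_of_nonneg (norm_nonneg _)).2 fun i => ?_
    fin_cases i
    · exact (key _ h1).trans_le (norm_fst_le p)
    · exact (key _ h2).trans_le (norm_snd_le p)
  · rw [Prod.norm_def]
    refine max_le ?_ ?_
    · exact (key _ h1).symm.trans_le (norm_le_pi_norm (projPair p) 0)
    · exact (key _ h2).symm.trans_le (norm_le_pi_norm (projPair p) 1)

/-- A tent function on the torus supported near the origin. -/
def tent (r : ℝ) : C(Torus, ℝ) := ⟨fun x => max 0 (r - ‖x‖), by fun_prop⟩

theorem tent_eq_zero {r : ℝ} {x : Torus} (h : r ≤ ‖x‖) : tent r x = 0 :=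
  max_eq_left (by linarith)

/-- The integral of the tent function over the plane. -/
def tentMass (r : ℝ) : ℝ := ∫ x : ℝ × ℝ, max 0 (r - ‖x‖)

theorem tentMass_pos {r : ℝ} (hr : 0 < r) : 0 < tentMass r := by
  refine Continuous.integral_pos_of_hasCompactSupport_nonneg_nonzero (x := 0) (by fun_prop)
    (HasCompactSupport.intro (isCompact_closedBall 0 r) fun x hx => ?_)
    (fun x => le_max_left _ _) (by simpa using hr)
  rw [mem_closedBall_zero_iff, not_le] at hx
  exact max_eq_left (by linarith)

/-- Within distance 1/2 of the lattice point `ℓ` the norm of the projection of `x` is ‖x - ℓ‖. On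
`S` the integrand is thus the planar tent centred at `ℓ`, whose support up to its boundary lies in
`S`. -/
theorem setIntegral_tent {r : ℝ} {ℓ : ℝ × ℝ} (hℓ : projPair ℓ = 0) {S : Set (ℝ × ℝ)}
    (hSm : MeasurableSet S) (h1 : S ⊆ Metric.closedBall ℓ (1 / 2)) (h2 : Metric.ball ℓ r ⊆ S) :
    ∫ x in S, tent r (projPair x) = tentMass r := by
  have hcompl : ∀ x ∉ S, max 0 (r - ‖x - ℓ‖) = 0 := fun x hx => by
    have : r ≤ ‖x - ℓ‖ := by
      by_contra! hlt
      exact hx (h2 (by simpa [dist_eq_norm] using hlt))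
    exact max_eq_left (by linarith)
  rw [tentMass, ← integral_sub_right_eq_self (fun x : ℝ × ℝ => max 0 (r - ‖x‖)) ℓ,
    ← setIntegral_eq_integral_of_forall_compl_eq_zero hcompl]
  refine setIntegral_congr_fun hSm fun x hx => ?_
  have hx' : ‖x - ℓ‖ ≤ 1 / 2 := by simpa [dist_eq_norm] using h1 hx
  have : projPair x = projPair (x - ℓ) := by rw [projPair_sub, hℓ, sub_zero]
  change max 0 (r - ‖projPair x‖) = _
  rw [this, norm_projPair hx']

theorem integral_tent {r : ℝ} (hr2 : r ≤ 1 / 2) :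
    ∫ x in (-1 / 2 : ℝ)..1 / 2, ∫ y in (-1 / 2 : ℝ)..1 / 2, tent r (proj ![x, y]) = tentMass r := by
  have hc : Continuous fun p : ℝ × ℝ => tent r (projPair p) :=
    (tent r).continuous.comp continuous_projPair
  have hi : IntegrableOn (fun p : ℝ × ℝ => tent r (projPair p))
      (Set.Ioc (-1 / 2) (1 / 2) ×ˢ Set.Ioc (-1 / 2) (1 / 2)) (volume.prod volume) :=
    (hc.continuousOn.integrableOn_compact (μ := (volume : Measure ℝ).prod volume)
      (isCompact_Icc.prod isCompact_Icc)).mono_set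
      (Set.prod_mono Set.Ioc_subset_Icc_self Set.Ioc_subset_Icc_self)
  have h := setIntegral_prod _ hi
  rw [← Measure.volume_eq_prod, setIntegral_tent (ℓ := 0) (by
    rw [projPair, proj_eq_zero_iff]; exact ⟨0, by ext i; fin_cases i <;> simp [lat]⟩)
    (measurableSet_Ioc.prod measurableSet_Ioc)] at h
  · simp only [intervalIntegral.integral_of_le (show (-1 / 2 : ℝ) ≤ 1 / 2 by norm_num)]
    exact h.symm
  · rintro ⟨x, y⟩ ⟨hx, hy⟩
    simp only [mem_closedBall_zero_iff, Prod.norm_def, Real.norm_eq_abs]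
    exact max_le (abs_le.2 ⟨by linarith [hx.1], hx.2⟩) (abs_le.2 ⟨by linarith [hy.1], hy.2⟩)
  · rintro ⟨x, y⟩ hxy
    simp only [mem_ball_zero_iff, Prod.norm_def, Real.norm_eq_abs, max_lt_iff, abs_lt] at hxy
    exact ⟨⟨by linarith [hxy.1.1], by linarith [hxy.1.2]⟩,
      ⟨by linarith [hxy.2.1], by linarith [hxy.2.2]⟩⟩

/-- The difference of two parametrised curves. -/
def diffMap (f g : ℝ → Plane) (p : ℝ × ℝ) : ℝ × ℝ := (f p.1 0 - g p.2 0, f p.1 1 - g p.2 1)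

theorem projPair_diffMap (f g : ℝ → Plane) (p : ℝ × ℝ) :
    projPair (diffMap f g p) = proj (f p.1 - g p.2) := by
  rw [projPair]
  congr 1
  ext i; fin_cases i <;> simp [diffMap]

/-- The derivative of `diffMap`. -/
def diffMapDeriv (f g : ℝ → Plane) (p : ℝ × ℝ) : ℝ × ℝ →L[ℝ] ℝ × ℝ :=
  (deriv f p.1 0 • ContinuousLinearMap.fst ℝ ℝ ℝ - deriv g p.2 0 • ContinuousLinearMap.snd ℝ ℝ ℝ).prod
    (deriv f p.1 1 • ContinuousLinearMap.fst ℝ ℝ ℝ - deriv g p.2 1 • ContinuousLinearMap.snd ℝ ℝ ℝ)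

theorem det_diffMapDeriv (f g : ℝ → Plane) (p : ℝ × ℝ) :
    (diffMapDeriv f g p).det = -wedge (deriv f p.1) (deriv g p.2) := by
  rw [ContinuousLinearMap.det, ← LinearMap.det_toMatrix (Module.Basis.finTwoProd ℝ),
    Matrix.det_fin_two]
  simp [LinearMap.toMatrix_apply, diffMapDeriv, wedge]
  ring

theorem hasStrictFDerivAt_diffMap {f g : ℝ → Plane} (hf : ContDiff ℝ ∞ f) (hg : ContDiff ℝ ∞ g)
    (p : ℝ × ℝ) : HasStrictFDerivAt (diffMap f g) (diffMapDeriv f g p) p := by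
  have key : ∀ {h : ℝ → Plane}, ContDiff ℝ ∞ h → ∀ i t, HasStrictDerivAt (fun t => h t i) (deriv h t i) t := by
    intro h hh i t
    exact hasStrictDerivAt_pi.1 (hh.contDiffAt.hasStrictDerivAt (by simp)) i
  have hF : ∀ i, HasStrictFDerivAt (fun p : ℝ × ℝ => f p.1 i - g p.2 i)
      (deriv f p.1 i • ContinuousLinearMap.fst ℝ ℝ ℝ - deriv g p.2 i • ContinuousLinearMap.snd ℝ ℝ ℝ) p :=
    fun i => ((key hf i p.1).comp_hasStrictFDerivAt p hasStrictFDerivAt_fst).sub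
      ((key hg i p.2).comp_hasStrictFDerivAt p hasStrictFDerivAt_snd)
  exact (hF 0).prodMk (hF 1)

theorem continuous_diffMap {f g : ℝ → Plane} (hf : ContDiff ℝ ∞ f) (hg : ContDiff ℝ ∞ g) :
    Continuous (diffMap f g) := by
  have := hf.continuous
  have := hg.continuous
  unfold diffMap
  fun_prop

/-- The sign of a real number as an integer, with `-1` at zero. -/
def isign (x : ℝ) : ℤ := if 0 < x then 1 else -1

/-- Recovers the signed density from the absolute Jacobian where the Jacobian keeps the sign it has
at the crossing. -/
theorem isign_mul_abs {x y : ℝ} (h : 0 < x * y) : (isign y : ℝ) * |x| = x := by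
  unfold isign
  split_ifs with hy
  · rw [abs_of_pos (pos_of_mul_pos_left h hy.le)]; simp
  · have hx : x < 0 := by
      rcases lt_trichotomy x 0 with hx | rfl | hx
      · exact hx
      · simp at h
      · exact absurd (pos_of_mul_pos_right h hx.le) hy
    rw [abs_of_neg hx]; simp

/-- Near a transverse crossing, the crossing density of a tent function integrates to the
sign of the crossing. -/
theorem exists_local_crossing {f g : ℝ → Plane} (hf : ContDiff ℝ ∞ f) (hg : ContDiff ℝ ∞ g)
    {p : ℝ × ℝ} (hp : proj (f p.1 - g p.2) = 0) (hJ : wedge (deriv f p.1) (deriv g p.2) ≠ 0)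
    {W : Set (ℝ × ℝ)} (hW : IsOpen W) (hpW : p ∈ W) :
    ∃ V ⊆ W, IsOpen V ∧ p ∈ V ∧ (∀ q ∈ V, proj (f q.1 - g q.2) = 0 → q = p) ∧
      ∃ r₀ > 0, ∀ r ≤ r₀, ∫ q in V, tent r (proj (f q.1 - g q.2)) *
        wedge (deriv f q.1) (deriv g q.2) = isign (wedge (deriv f p.1) (deriv g p.2)) * tentMass r := by
  set F := diffMap f g with hF
  set J : ℝ × ℝ → ℝ := fun q => wedge (deriv f q.1) (deriv g q.2) with hJdef
  have hJc : Continuous J := continuous_wedge_deriv hf hg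
  have hFc : Continuous F := continuous_diffMap hf hg
  have hdet : (diffMapDeriv f g p).det ≠ 0 := by
    rw [det_diffMapDeriv]
    exact neg_ne_zero.2 hJ
  have hstrict : HasStrictFDerivAt F
      ((diffMapDeriv f g p).toContinuousLinearEquivOfDetNeZero hdet : ℝ × ℝ →L[ℝ] ℝ × ℝ) p := by
    convert hasStrictFDerivAt_diffMap hf hg p
    exact ContinuousLinearMap.ext fun x => rfl
  set e := hstrict.toOpenPartialHomeomorph F with he
  have hcoe : (e : ℝ × ℝ → ℝ × ℝ) = F := hstrict.toOpenPartialHomeomorph_coe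
  have hpe : p ∈ e.source := hstrict.mem_toOpenPartialHomeomorph_source
  have hℓ : projPair (F p) = 0 := by rw [hF, projPair_diffMap, hp]
  -- On `V` the map `F` is injective, the Jacobian has constant sign, and the radius 1/2 prevents
  -- `F` from reaching another lattice point.
  let V := (e.source ∩ W) ∩ ({q | 0 < J q * J p} ∩ F ⁻¹' Metric.ball (F p) (1 / 2))
  have hVo : IsOpen V := (e.open_source.inter hW).inter
    ((isOpen_lt continuous_const (hJc.mul continuous_const)).inter (Metric.isOpen_ball.preimage hFc))
  have hpV : p ∈ V := ⟨⟨hpe, hpW⟩, mul_self_pos.2 hJ, by simp⟩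
  have hVs : V ⊆ e.source := fun q hq => hq.1.1
  have hinj : Set.InjOn F V := by
    rw [← hcoe]; exact e.injOn.mono hVs
  have himo : IsOpen (F '' V) := by
    rw [← hcoe]; exact e.isOpen_image_of_subset_source hVo hVs
  have himb : F '' V ⊆ Metric.closedBall (F p) (1 / 2) := by
    rintro _ ⟨q, hq, rfl⟩
    exact Metric.ball_subset_closedBall hq.2.2
  refine ⟨V, fun q hq => hq.1.2, hVo, hpV, fun q hq hq0 => ?_, ?_⟩
  · refine hinj hq hpV (sub_eq_zero.1 (norm_eq_zero.1 ?_))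
    have h1 : ‖F q - F p‖ ≤ 1 / 2 := by simpa [dist_eq_norm] using himb ⟨q, hq, rfl⟩
    rw [← norm_projPair h1, projPair_sub, hℓ, hF, projPair_diffMap, hq0]
    simp
  · obtain ⟨r₀, hr₀, hball⟩ := Metric.isOpen_iff.1 himo (F p) ⟨p, hpV, rfl⟩
    refine ⟨r₀, hr₀, fun r hr => ?_⟩
    have hcv := integral_image_eq_integral_abs_det_fderiv_smul volume hVo.measurableSet
      (fun q _ => (hasStrictFDerivAt_diffMap hf hg q).hasFDerivAt.hasFDerivWithinAt) hinj
      (fun x => tent r (projPair x))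
    rw [setIntegral_tent hℓ himo.measurableSet himb ((Metric.ball_subset_ball hr).trans hball)] at hcv
    rw [hcv, ← integral_const_mul]
    refine setIntegral_congr_fun hVo.measurableSet fun q hq => ?_
    have h2 := isign_mul_abs hq.2.1
    change tent r (proj (f q.1 - g q.2)) * J q = _
    rw [det_diffMapDeriv, abs_neg, projPair_diffMap, smul_eq_mul]
    change _ = (isign (J p) : ℝ) * (|J q| * _)
    nth_rewrite 1 [← h2]
    ring

/-- The parameters at which two parametrised curves meet on the torus. -/
def meets (f g : ℝ → Plane) : Set (ℝ × ℝ) := {p | proj (f p.1 - g p.2) = 0}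

theorem isClosed_meets {f g : ℝ → Plane} (hf : ContDiff ℝ ∞ f) (hg : ContDiff ℝ ∞ g) :
    IsClosed (meets f g) := by
  have := hf.continuous
  have := hg.continuous
  exact isClosed_singleton.preimage
    (continuous_proj.comp (by fun_prop : Continuous fun p : ℝ × ℝ => f p.1 - g p.2))

/-- Transverse crossings are isolated, and the set of crossings is closed. -/
theorem finite_meets_inter {f g : ℝ → Plane} (hf : ContDiff ℝ ∞ f) (hg : ContDiff ℝ ∞ g)
    (hJ : ∀ p ∈ meets f g, wedge (deriv f p.1) (deriv g p.2) ≠ 0) {K : Set (ℝ × ℝ)}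
    (hK : IsCompact K) : (meets f g ∩ K).Finite := by
  classical
  have hC : IsCompact (meets f g ∩ K) := hK.inter_left (isClosed_meets hf hg)
  have hV : ∀ p : ℝ × ℝ, ∃ V : Set (ℝ × ℝ), p ∈ meets f g →
      V ∈ nhds p ∧ ∀ q ∈ V, q ∈ meets f g → q = p := by
    intro p
    by_cases hp : p ∈ meets f g
    · obtain ⟨V, -, hVo, hpV, hV, -⟩ := exists_local_crossing hf hg hp (hJ p hp) isOpen_univ
        (Set.mem_univ p)
      exact ⟨V, fun _ => ⟨hVo.mem_nhds hpV, hV⟩⟩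
    · exact ⟨∅, fun h => absurd h hp⟩
  choose V hV using hV
  obtain ⟨t, ht, hcov⟩ := hC.elim_nhds_subcover V fun p hp => (hV p hp.1).1
  refine t.finite_toSet.subset fun q hq => ?_
  obtain ⟨p, hp, hqp⟩ := Set.mem_iUnion₂.1 (hcov hq)
  rw [(hV p (ht p hp).1).2 q hqp hq.1]
  exact hp

/-- If no crossing lies on the boundary of a period square, then the signs of the crossings in the
square add up to the determinant of the winding vectors. -/
theorem sum_isign_eq_of_interior {f g : ℝ → Plane} (hf : ContDiff ℝ ∞ f) (hg : ContDiff ℝ ∞ g)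
    {a b : Fin 2 → ℤ} (ha : ∀ t, f (t + 1) = f t + lat a) (hb : ∀ t, g (t + 1) = g t + lat b)
    (hJ : ∀ p ∈ meets f g, wedge (deriv f p.1) (deriv g p.2) ≠ 0) {s₀ t₀ : ℝ}
    {C : Finset (ℝ × ℝ)}
    (hC : ∀ p, p ∈ C ↔ p ∈ meets f g ∧ p ∈ Set.Icc s₀ (s₀ + 1) ×ˢ Set.Icc t₀ (t₀ + 1))
    (hint : ∀ p ∈ C, p ∈ Set.Ioo s₀ (s₀ + 1) ×ˢ Set.Ioo t₀ (t₀ + 1)) :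
    ∑ p ∈ C, isign (wedge (deriv f p.1) (deriv g p.2)) = idet a b := by
  classical
  obtain ⟨U, hU, hUd⟩ := C.finite_toSet.t2_separation
  have hQo : IsOpen (Set.Ioo s₀ (s₀ + 1) ×ˢ Set.Ioo t₀ (t₀ + 1)) := isOpen_Ioo.prod isOpen_Ioo
  have hloc : ∀ p : ℝ × ℝ, ∃ V : Set (ℝ × ℝ), ∃ r₀ : ℝ, p ∈ C →
      V ⊆ U p ∩ Set.Ioo s₀ (s₀ + 1) ×ˢ Set.Ioo t₀ (t₀ + 1) ∧ IsOpen V ∧ p ∈ V ∧ 0 < r₀ ∧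
      ∀ r ≤ r₀, ∫ q in V, tent r (proj (f q.1 - g q.2)) *
        wedge (deriv f q.1) (deriv g q.2) =
          isign (wedge (deriv f p.1) (deriv g p.2)) * tentMass r := by
    intro p
    by_cases hp : p ∈ C
    · have hpm := ((hC p).1 hp).1
      obtain ⟨V, hVW, hVo, hpV, -, r₀, hr₀, h⟩ := exists_local_crossing hf hg hpm (hJ p hpm)
        ((hU p).2.inter hQo) ⟨(hU p).1, hint p hp⟩
      exact ⟨V, r₀, fun _ => ⟨hVW, hVo, hpV, hr₀, h⟩⟩
    · exact ⟨∅, 0, fun h => absurd h hp⟩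
  choose V r₀ hV using hloc
  set Q := Set.Icc s₀ (s₀ + 1) ×ˢ Set.Icc t₀ (t₀ + 1) with hQ
  have hQc : IsCompact Q := isCompact_Icc.prod isCompact_Icc
  have hVuo : IsOpen (⋃ p ∈ C, V p) := isOpen_biUnion fun p hp => (hV p hp).2.1
  have hfc := hf.continuous
  have hgc := hg.continuous
  have hPc : Continuous fun q : ℝ × ℝ => proj (f q.1 - g q.2) :=
    continuous_proj.comp (by fun_prop)
  have hδ' : ∃ δ : ℝ, 0 < δ ∧ ∀ q ∈ Q \ ⋃ p ∈ C, V p, δ ≤ ‖proj (f q.1 - g q.2)‖ :=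
    (hQc.diff hVuo).exists_forall_le' hPc.norm.continuousOn (a := (0 : ℝ)) (by
      rintro q ⟨hq, hq'⟩
      refine norm_pos_iff.2 fun h0 => hq' ?_
      have hqC : q ∈ C := (hC q).2 ⟨h0, hq⟩
      exact Set.mem_biUnion hqC (hV q hqC).2.2.1)
  obtain ⟨δ, hδ, hδle⟩ := hδ'
  -- The three bounds on `r` serve the local formula at each crossing, the vanishing of the density
  -- off the neighbourhoods `V p`, and the total mass of the tent on the torus.
  have hev : ∀ᶠ r in nhdsWithin (0 : ℝ) (Set.Ioi 0), (∀ p ∈ (C : Set (ℝ × ℝ)), r < r₀ p) ∧ r < δ ∧ r < 1 / 2 := by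
    have h1 : ∀ {x : ℝ}, 0 < x → ∀ᶠ r in nhdsWithin (0 : ℝ) (Set.Ioi 0), r < x := fun hx =>
      nhdsWithin_le_nhds (Iio_mem_nhds hx)
    refine ((Filter.eventually_all_finite C.finite_toSet).2 fun p hp => h1 (hV p hp).2.2.2.1).and
      ((h1 hδ).and (h1 (by norm_num)))
  obtain ⟨r, ⟨hr1, hr2, hr3⟩, hr0⟩ := (hev.and self_mem_nhdsWithin).exists
  set h : ℝ × ℝ → ℝ := fun q => tent r (proj (f q.1 - g q.2)) * wedge (deriv f q.1) (deriv g q.2)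
    with hh
  have hhc : Continuous h := ((tent r).continuous.comp hPc).mul (continuous_wedge_deriv hf hg)
  have hhi : IntegrableOn h Q := hhc.continuousOn.integrableOn_compact hQc
  have hVQ : ∀ p ∈ C, V p ⊆ Set.Ioo s₀ (s₀ + 1) ×ˢ Set.Ioo t₀ (t₀ + 1) := fun p hp q hq =>
    ((hV p hp).1 hq).2
  have hIooQ : Set.Ioo s₀ (s₀ + 1) ×ˢ Set.Ioo t₀ (t₀ + 1) ⊆ Q :=
    Set.prod_mono Set.Ioo_subset_Icc_self Set.Ioo_subset_Icc_self
  have hIoc : Set.Ioc s₀ (s₀ + 1) ×ˢ Set.Ioc t₀ (t₀ + 1) ⊆ Q :=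
    Set.prod_mono Set.Ioc_subset_Icc_self Set.Ioc_subset_Icc_self
  have hdeg := integral_crossing hf hg ha hb s₀ t₀ (tent r)
  rw [integral_tent hr3.le] at hdeg
  have hprod := setIntegral_prod (μ := volume) (ν := volume) h (hhi.mono_set hIoc)
  rw [← Measure.volume_eq_prod] at hprod
  have h1 : ∫ q in Set.Ioc s₀ (s₀ + 1) ×ˢ Set.Ioc t₀ (t₀ + 1), h q = idet a b * tentMass r := by
    rw [hprod, ← hdeg]
    simp only [intervalIntegral.integral_of_le (show s₀ ≤ s₀ + 1 by linarith),
      intervalIntegral.integral_of_le (show t₀ ≤ t₀ + 1 by linarith)]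
    rfl
  have h2 : ∫ q in Set.Ioc s₀ (s₀ + 1) ×ˢ Set.Ioc t₀ (t₀ + 1), h q = ∫ q in ⋃ p ∈ C, V p, h q := by
    refine setIntegral_eq_of_subset_of_forall_sdiff_eq_zero
      (measurableSet_Ioc.prod measurableSet_Ioc) ?_ fun q hq => ?_
    · refine Set.iUnion₂_subset fun p hp => (hVQ p hp).trans
        (Set.prod_mono Set.Ioo_subset_Ioc_self Set.Ioo_subset_Ioc_self)
    · have := hδle q ⟨hIoc hq.1, hq.2⟩
      rw [hh]
      simp only
      rw [tent_eq_zero (hr2.le.trans this), zero_mul]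
  have h3 : ∫ q in ⋃ p ∈ C, V p, h q =
      ∑ p ∈ C, (isign (wedge (deriv f p.1) (deriv g p.2)) : ℝ) * tentMass r := by
    rw [integral_biUnion_finset C (fun p hp => (hV p hp).2.1.measurableSet)]
    · exact Finset.sum_congr rfl fun p hp => (hV p hp).2.2.2.2 r (hr1 p hp).le
    · intro p hp q hq hpq
      exact (hUd hp hq hpq).mono (fun x hx => ((hV p hp).1 hx).1) (fun x hx => ((hV q hq).1 hx).1)
    · exact fun p hp => hhi.mono_set ((hVQ p hp).trans hIooQ)
  rw [h1, h3, ← Finset.sum_mul] at h2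
  have h4 := mul_right_cancel₀ (tentMass_pos hr0).ne' h2
  exact_mod_cast h4.symm

/-- The signs of the crossings of two transverse curves over a suitable period square add up to the
determinant of the winding vectors. -/
theorem exists_sum_isign_eq {f g : ℝ → Plane} (hf : ContDiff ℝ ∞ f) (hg : ContDiff ℝ ∞ g)
    {a b : Fin 2 → ℤ} (ha : ∀ t, f (t + 1) = f t + lat a) (hb : ∀ t, g (t + 1) = g t + lat b)
    (hJ : ∀ p ∈ meets f g, wedge (deriv f p.1) (deriv g p.2) ≠ 0) :
    ∃ (s₀ t₀ : ℝ) (C : Finset (ℝ × ℝ)),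
      (∀ p, p ∈ C ↔ p ∈ meets f g ∧ p ∈ Set.Ico s₀ (s₀ + 1) ×ˢ Set.Ico t₀ (t₀ + 1)) ∧
      ∑ p ∈ C, isign (wedge (deriv f p.1) (deriv g p.2)) = idet a b := by
  classical
  have hfin : ∀ s t : ℝ, (meets f g ∩ Set.Icc s (s + 1) ×ˢ Set.Icc t (t + 1)).Finite := fun s t =>
    finite_meets_inter hf hg hJ (isCompact_Icc.prod isCompact_Icc)
  have hpf : Function.Periodic (fun t => proj (f t)) 1 := fun t => by simp [ha, proj_add]
  have hpg : Function.Periodic (fun t => proj (g t)) 1 := fun t => by simp [hb, proj_add]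
  have hmf : ∀ s t, (s, t) ∈ meets f g → (Int.fract s, Int.fract t) ∈ meets f g := fun s t h => by
    have h1 := hpf.sub_int_mul_eq (x := s) ⌊s⌋
    have h2 := hpg.sub_int_mul_eq (x := t) ⌊t⌋
    simp only [mul_one, Int.self_sub_floor] at h1 h2
    have h3 : proj (f s - g t) = 0 := h
    change proj (f (Int.fract s) - g (Int.fract t)) = 0
    rw [proj_sub] at h3 ⊢
    rw [h1, h2, h3]
  have hfr : ∀ x : ℝ, Int.fract x ∈ Set.Icc (0 : ℝ) (0 + 1) := fun x =>
    ⟨Int.fract_nonneg x, by simpa using (Int.fract_lt_one x).le⟩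
  -- Only finitely many coordinates of crossings occur modulo 1. A corner that avoids them keeps
  -- every crossing off the boundary of the square.
  obtain ⟨s₀, hs₀, hs₀'⟩ := (Set.Ioo_infinite (zero_lt_one' ℝ)).exists_notMem_finite
    ((hfin 0 0).image Prod.fst)
  obtain ⟨t₀, ht₀, ht₀'⟩ := (Set.Ioo_infinite (zero_lt_one' ℝ)).exists_notMem_finite
    ((hfin 0 0).image Prod.snd)
  have hfs : Int.fract s₀ = s₀ := Int.fract_eq_self.2 ⟨hs₀.1.le, hs₀.2⟩
  have hft : Int.fract t₀ = t₀ := Int.fract_eq_self.2 ⟨ht₀.1.le, ht₀.2⟩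
  have hns : ∀ s t, (s, t) ∈ meets f g → Int.fract s ≠ s₀ := fun s t h hs =>
    hs₀' ⟨(Int.fract s, Int.fract t), ⟨hmf s t h, hfr s, hfr t⟩, hs⟩
  have hnt : ∀ s t, (s, t) ∈ meets f g → Int.fract t ≠ t₀ := fun s t h ht =>
    ht₀' ⟨(Int.fract s, Int.fract t), ⟨hmf s t h, hfr s, hfr t⟩, ht⟩
  have hne : ∀ {x y : ℝ}, Int.fract x = x → Int.fract y ≠ x → y ∈ Set.Icc x (x + 1) →
      y ∈ Set.Ioo x (x + 1) := fun {x y} hx hy hxy =>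
    ⟨lt_of_le_of_ne hxy.1 (by rintro rfl; exact hy hx), lt_of_le_of_ne hxy.2 (by
      rintro rfl; exact hy (by rw [Int.fract_add_one, hx]))⟩
  have hint : ∀ p ∈ meets f g, p ∈ Set.Icc s₀ (s₀ + 1) ×ˢ Set.Icc t₀ (t₀ + 1) →
      p ∈ Set.Ioo s₀ (s₀ + 1) ×ˢ Set.Ioo t₀ (t₀ + 1) := fun p hp hpQ =>
    ⟨hne hfs (hns p.1 p.2 hp) hpQ.1, hne hft (hnt p.1 p.2 hp) hpQ.2⟩
  refine ⟨s₀, t₀, (hfin s₀ t₀).toFinset, fun p => ?_, ?_⟩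
  · rw [Set.Finite.mem_toFinset]
    refine ⟨fun h => ⟨h.1, ?_⟩, fun h => ⟨h.1, ?_⟩⟩
    · have := hint p h.1 h.2
      exact Set.prod_mono Set.Ioo_subset_Ico_self Set.Ioo_subset_Ico_self this
    · exact Set.prod_mono Set.Ico_subset_Icc_self Set.Ico_subset_Icc_self h.2
  · refine sum_isign_eq_of_interior hf hg ha hb hJ (s₀ := s₀) (t₀ := t₀) (fun p => ?_) fun p hp => ?_
    · rw [Set.Finite.mem_toFinset]; rfl
    · rw [Set.Finite.mem_toFinset] at hp
      exact hint p hp.1 hp.2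

end LocalDegree

/-! ### Goldman's formula in terms of winding vectors -/

theorem velocity_coe {γ : SmoothLoop} {f : ℝ → Plane} (hf : IsSmoothLift γ.loop f) (t : ℝ) :
    γ.velocity (t : UnitAddCircle) = deriv f t := by
  have hc := γ.smooth.choose_spec
  rw [SmoothLoop.velocity, AddCircle.coe_equivIco_mk_apply]
  set g := γ.smooth.choose
  obtain ⟨n, hn⟩ := exists_isLift hf.1.continuous hf.2
  have h1 : ∀ k : ℤ, ∀ s, proj (f (s + k)) = proj (f s) := fun k s => by
    have h0 : ((k : ℝ) : UnitAddCircle) = 0 := (AddCircle.coe_eq_zero_iff 1).2 ⟨k, by simp⟩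
    rw [← hf.2, ← hf.2, AddCircle.coe_add, h0, add_zero]
  have hmod : t = Int.fract (t / 1) * 1 + ⌊t⌋ := by simp [Int.fract_add_floor]
  set r := Int.fract (t / 1) * 1
  obtain ⟨m, hm⟩ := proj_eq_proj_iff.1
    (((h1 ⌊t⌋ 0).trans (hf.2 0).symm).trans (hc.2 0))
  -- Shifted by an integer, `f` lifts the same loop as the chosen lift `g`, so the two differ by a
  -- constant and have equal derivatives.
  have hEq : (fun s => f (s + ⌊t⌋)) = fun s => g s + lat m := by
    funext s
    exact eqOn_of_proj_eqOn (S := Set.univ) isPreconnected_univ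
      (f := fun s => f (s + ⌊t⌋)) (g := fun s => g s + lat m)
      (by have := hf.1.continuous; fun_prop) (by have := hc.1.continuous; fun_prop)
      (fun s _ => by rw [h1, proj_add, proj_lat, add_zero, ← hf.2, ← hc.2]) (Set.mem_univ 0)
      (by simp [← hm]) (Set.mem_univ s)
  have h2 := congrArg (fun F => deriv F r) hEq
  simp only [deriv_comp_add_const, deriv_add_const] at h2
  rw [← hmod] at h2
  exact h2.symm

theorem wedge_ne_zero_iff {u v : Plane} : wedge u v ≠ 0 ↔ LinearIndependent ℝ ![u, v] := by
  rw [LinearIndependent.pair_iff]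
  constructor
  · intro h s t hst
    have h0 := congrFun hst 0
    have h1 := congrFun hst 1
    simp at h0 h1
    constructor
    · refine (mul_eq_zero.1 ?_).resolve_right h
      rw [wedge]; linear_combination v 1 * h0 - v 0 * h1
    · refine (mul_eq_zero.1 ?_).resolve_right h
      rw [wedge]; linear_combination u 0 * h1 - u 1 * h0
  · intro h hw
    rw [wedge] at hw
    have hz : ∀ i, u i = 0 ∧ v i = 0 := fun i => by
      have := h (-v i) (u i) (by
        ext j; fin_cases i <;> fin_cases j <;> simp <;> linarith)
      exact ⟨this.2, by linarith [this.1]⟩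
    have := h 1 0 (by ext j; simp [(hz j).1])
    exact one_ne_zero this.1

/-- The sign of an orientation of the plane, relative to the standard orientation. -/
def orientationSign (o : Orientation ℝ Plane (Fin 2)) : ℤ :=
  open Classical in if (Pi.basisFun ℝ (Fin 2)).orientation = o then 1 else -1

theorem orientationSign_mul_self (o : Orientation ℝ Plane (Fin 2)) :
    orientationSign o * orientationSign o = 1 := by
  unfold orientationSign; split_ifs <;> simp

/-- The plane has just two orientations, so matching `o` means agreeing with the standard one
exactly when `o` does. -/
theorem exists_basis_orientation_iff (o : Orientation ℝ Plane (Fin 2)) {u v : Plane}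
    (h : wedge u v ≠ 0) :
    (∃ b : Module.Basis (Fin 2) ℝ Plane, b 0 = u ∧ b 1 = v ∧ b.orientation = o) ↔
      (0 < wedge u v ↔ (Pi.basisFun ℝ (Fin 2)).orientation = o) := by
  have hdet : ∀ b : Module.Basis (Fin 2) ℝ Plane, b 0 = u → b 1 = v →
      (Pi.basisFun ℝ (Fin 2)).det b = wedge u v := fun b h0 h1 => by
    rw [Pi.basisFun_det_apply, Matrix.det_fin_two, wedge, ← h0, ← h1]
    simp only [Matrix.of_apply]
  have key : ∀ b : Module.Basis (Fin 2) ℝ Plane, b 0 = u → b 1 = v →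
      (b.orientation = o ↔ (0 < wedge u v ↔ (Pi.basisFun ℝ (Fin 2)).orientation = o)) := by
    intro b h0 h1
    have h2 := Module.Basis.orientation_eq_iff_det_pos (Pi.basisFun ℝ (Fin 2)) b
    rw [hdet b h0 h1] at h2
    rw [← h2]
    by_cases ho : (Pi.basisFun ℝ (Fin 2)).orientation = o
    · simp only [ho, iff_true]; exact eq_comm
    · simp only [ho, iff_false]
      have h3 := (Module.Basis.orientation_ne_iff_eq_neg _ _).1 (Ne.symm ho)
      rw [h3, ← Module.Basis.orientation_ne_iff_eq_neg]
      exact ne_comm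
  constructor
  · rintro ⟨b, h0, h1, hb⟩
    exact (key b h0 h1).1 hb
  · intro hb
    let b := basisOfLinearIndependentOfCardEqFinrank (wedge_ne_zero_iff.1 h) (by simp)
    have h0 : b 0 = u := by simp [b]
    have h1 : b 1 = v := by simp [b]
    exact ⟨b, h0, h1, (key b h0 h1).2 hb⟩

theorem crossingSign_eq (o : Orientation ℝ Plane (Fin 2)) {α β : SmoothLoop}
    {p : UnitAddCircle × UnitAddCircle} (h : wedge (α.velocity p.1) (β.velocity p.2) ≠ 0) :
    crossingSign o α β p =
      orientationSign o * isign (wedge (α.velocity p.1) (β.velocity p.2)) := by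
  classical
  rw [crossingSign, if_congr (exists_basis_orientation_iff o h) rfl rfl, orientationSign, isign]
  split_ifs <;> simp_all

/-- Goldman's formula on the torus: the bracket of transverse loops with winding vectors `a`, `b`
is `± det(a, b)` times the class with winding vector `a + b`. -/
theorem goldmanSum_eq (o : Orientation ℝ Plane (Fin 2)) {α β : SmoothLoop}
    (h : TransverseDoublePoints α β) :
    goldmanSum o α β = Finsupp.single (classEquiv.symm (winding α.loop + winding β.loop))
      (orientationSign o * idet (winding α.loop) (winding β.loop)) := by
  classical
  obtain ⟨f, hf⟩ := α.smooth
  obtain ⟨g, hg⟩ := β.smooth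
  obtain ⟨a, ha⟩ := exists_isLift hf.1.continuous hf.2
  obtain ⟨b, hb⟩ := exists_isLift hg.1.continuous hg.2
  have hwa : winding α.loop = a := HasWinding.winding_eq ⟨f, ha⟩
  have hwb : winding β.loop = b := HasWinding.winding_eq ⟨g, hb⟩
  have hm : ∀ p : ℝ × ℝ, p ∈ meets f g ↔
      ((p.1 : UnitAddCircle), (p.2 : UnitAddCircle)) ∈ crossings α β := fun p => by
    change proj (f p.1 - g p.2) = 0 ↔ α.loop _ = β.loop _
    rw [hf.2, hg.2, proj_sub, sub_eq_zero]
  have hJ : ∀ p ∈ meets f g, wedge (deriv f p.1) (deriv g p.2) ≠ 0 := fun p hp => by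
    rw [wedge_ne_zero_iff, ← velocity_coe hf, ← velocity_coe hg]
    exact h.transverse ((p.1 : UnitAddCircle), (p.2 : UnitAddCircle)) ((hm p).1 hp)
  obtain ⟨s₀, t₀, C, hC, hsum⟩ := exists_sum_isign_eq hf.1 hg.1 ha.add_one hb.add_one hJ
  -- The square is half-open, so each crossing on the circles has exactly one representative in `C`.
  let e : C → crossings α β := fun p =>
    ⟨((p.1.1 : UnitAddCircle), (p.1.2 : UnitAddCircle)), (hm p.1).1 ((hC p.1).1 p.2).1⟩
  have he : Function.Bijective e := by
    constructor
    · rintro ⟨p, hp⟩ ⟨q, hq⟩ hpq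
      have h1 := congrArg (fun x => x.1.1) hpq
      have h2 := congrArg (fun x => x.1.2) hpq
      have hp' := ((hC p).1 hp).2
      have hq' := ((hC q).1 hq).2
      have h3 := (AddCircle.coe_eq_coe_iff_of_mem_Ico hp'.1 hq'.1).1 h1
      have h4 := (AddCircle.coe_eq_coe_iff_of_mem_Ico hp'.2 hq'.2).1 h2
      exact Subtype.ext (Prod.ext h3 h4)
    · rintro ⟨⟨x, y⟩, hxy⟩
      obtain ⟨s, hs, rfl⟩ : x ∈ ((↑) : ℝ → UnitAddCircle) '' Set.Ico s₀ (s₀ + 1) := by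
        rw [AddCircle.coe_image_Ico_eq]; trivial
      obtain ⟨t, ht, rfl⟩ : y ∈ ((↑) : ℝ → UnitAddCircle) '' Set.Ico t₀ (t₀ + 1) := by
        rw [AddCircle.coe_image_Ico_eq]; trivial
      exact ⟨⟨(s, t), (hC (s, t)).2 ⟨(hm (s, t)).2 hxy, hs, ht⟩⟩, rfl⟩
  have hterm : ∀ p : C, Finsupp.single (classEquiv.symm (a + b))
      (orientationSign o * isign (wedge (deriv f p.1.1) (deriv g p.1.2))) =
      Finsupp.single (freeClass (loopProduct α.loop β.loop (e p).2)) (crossingSign o α β (e p).1) := by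
    intro p
    have h1 : freeClass (loopProduct α.loop β.loop (e p).2) = classEquiv.symm (a + b) := by
      rw [Equiv.eq_symm_apply, classEquiv_freeClass]
      exact (HasWinding.loopProduct ⟨f, ha⟩ ⟨g, hb⟩ (e p).2).winding_eq
    have h2 := hJ p.1 ((hC p.1).1 p.2).1
    rw [h1, crossingSign_eq]
    · simp only [e]
      rw [velocity_coe hf, velocity_coe hg]
    · simp only [e]
      rwa [velocity_coe hf, velocity_coe hg]
  rw [hwa, hwb, goldmanSum, ← finsum_eq_of_bijective e he hterm, finsum_eq_sum_of_fintype,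
    ← hsum, ← Finset.sum_coe_sort C, Finset.mul_sum]
  exact (map_sum (Finsupp.singleAddHom (classEquiv.symm (a + b))) _ _).symm

/-! ### Transverse representatives of all pairs of classes -/

/-- The smooth loop with a given equivariant smooth lift. -/
theorem exists_smoothLoop {f : ℝ → Plane} (hf : ContDiff ℝ ∞ f) {a : Fin 2 → ℤ}
    (ha : ∀ t, f (t + 1) = f t + lat a) :
    ∃ γ : SmoothLoop, IsSmoothLift γ.loop f ∧ winding γ.loop = a := by
  have hp : Function.Periodic (fun t => proj (f t)) 1 := fun t => by simp [ha, proj_add]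
  let γ : Loop := ⟨hp.lift, continuous_quot_lift _ (continuous_proj.comp hf.continuous)⟩
  have hγ : IsSmoothLift γ f := ⟨hf, fun t => hp.lift_coe t⟩
  exact ⟨⟨γ, f, hγ⟩, hγ, HasWinding.winding_eq ⟨f, hf.continuous, hγ.2, ha⟩⟩

theorem exists_transverse_of_idet_eq_zero {a b : Fin 2 → ℤ} (h : idet a b = 0) :
    ∃ α β : SmoothLoop, TransverseDoublePoints α β ∧ winding α.loop = a ∧ winding β.loop = b := by
  obtain ⟨w, hw, hwa, hwb⟩ : ∃ w : Fin 2 → ℤ, w ≠ 0 ∧ idet w a = 0 ∧ idet w b = 0 := by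
    by_cases ha : a = 0
    · by_cases hb : b = 0
      · exact ⟨![1, 0], by simp, by simp [idet, ha], by simp [idet, hb]⟩
      · exact ⟨b, hb, by simp [idet, ha], by simp [idet, mul_comm]⟩
    · exact ⟨a, ha, by simp [idet, mul_comm], h⟩
  have hN : (0 : ℝ) < (w 0 : ℝ) ^ 2 + (w 1 : ℝ) ^ 2 := by
    by_contra! hle
    have h0 : (w 0 : ℝ) = 0 := by nlinarith [sq_nonneg (w 0 : ℝ), sq_nonneg (w 1 : ℝ)]
    have h1 : (w 1 : ℝ) = 0 := by nlinarith [sq_nonneg (w 0 : ℝ), sq_nonneg (w 1 : ℝ)]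
    exact hw (by ext i; fin_cases i <;> simp_all)
  -- Both curves run along `w` or are constant. A translation across `w` with determinant 1/2
  -- separates them, since an intersection would make this determinant an integer. The witness is
  -- `w` turned by a right angle and divided by 2|w|².
  obtain ⟨c, hc⟩ : ∃ c : Plane, wedge (lat w) c = 1 / 2 := by
    refine ⟨![-w 1 / (2 * ((w 0 : ℝ) ^ 2 + (w 1 : ℝ) ^ 2)),
      w 0 / (2 * ((w 0 : ℝ) ^ 2 + (w 1 : ℝ) ^ 2))], ?_⟩
    simp [wedge, lat]
    field_simp
    ring
  obtain ⟨α, hα, hαw⟩ := exists_smoothLoop (f := fun s => s • lat a) (a := a) (by fun_prop)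
    (fun t => by rw [add_smul, one_smul])
  obtain ⟨β, hβ, hβw⟩ := exists_smoothLoop (f := fun t => t • lat b + c) (a := b) (by fun_prop)
    (fun t => by rw [add_smul, one_smul]; abel)
  have hempty : ∀ p, p ∉ crossings α β := by
    rintro ⟨x, y⟩ hxy
    obtain ⟨s, rfl⟩ := QuotientAddGroup.mk_surjective x
    obtain ⟨t, rfl⟩ := QuotientAddGroup.mk_surjective y
    have h1 : proj (s • lat a) = proj (t • lat b + c) := by
      rw [← hα.2, ← hβ.2]; exact hxy
    obtain ⟨n, hn⟩ := proj_eq_proj_iff.1 h1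
    have h2 : wedge (lat w) (s • lat a - (t • lat b + c)) =
        s * wedge (lat w) (lat a) - t * wedge (lat w) (lat b) - wedge (lat w) c := by
      simp [wedge]; ring
    rw [hn, wedge_lat, wedge_lat, wedge_lat, hwa, hwb, hc] at h2
    have h3 : (2 * idet w n : ℝ) = -1 := by rw [h2]; norm_num
    have h4 : 2 * idet w n = -1 := by exact_mod_cast h3
    omega
  exact ⟨α, β, ⟨fun p hp => absurd hp (hempty p), fun p hp => absurd hp (hempty p),
    fun p hp => absurd hp (hempty p)⟩, hαw, hβw⟩

/-- A straight closed curve in direction `a`, perturbed in direction `b`. -/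
def wave (a b : Fin 2 → ℤ) (ε : ℝ) (c : Plane) (s : ℝ) : Plane :=
  s • lat a + (ε * Real.sin (2 * Real.pi * s)) • lat b + c

theorem contDiff_wave (a b : Fin 2 → ℤ) (ε : ℝ) (c : Plane) : ContDiff ℝ ∞ (wave a b ε c) := by
  unfold wave
  fun_prop

theorem wave_add_one (a b : Fin 2 → ℤ) (ε : ℝ) (c : Plane) (t : ℝ) :
    wave a b ε c (t + 1) = wave a b ε c t + lat a := by
  unfold wave
  rw [mul_add, mul_one, Real.sin_add_two_pi, add_smul, one_smul]
  abel

theorem deriv_wave (a b : Fin 2 → ℤ) (ε : ℝ) (c : Plane) (t : ℝ) :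
    deriv (wave a b ε c) t = lat a + (ε * (2 * Real.pi * Real.cos (2 * Real.pi * t))) • lat b := by
  have h1 : HasDerivAt (fun s : ℝ => ε * Real.sin (2 * Real.pi * s))
      (ε * (2 * Real.pi * Real.cos (2 * Real.pi * t))) t := by
    have := ((hasDerivAt_id' t).const_mul (2 * Real.pi)).sin.const_mul ε
    exact this.congr_deriv (by ring)
  have h2 := (((hasDerivAt_id' t).smul_const (lat a)).fun_add (h1.smul_const (lat b))).add_const c
  rw [one_smul] at h2
  exact h2.deriv

/-- The self-crossings of a slightly perturbed straight curve occur at special parameters only. -/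
theorem wave_selfCrossing {a b : Fin 2 → ℤ} {ε : ℝ} (hε : |ε * idet a b| ≤ 1 / 16)
    (hε0 : ε * idet a b ≠ 0) {c : Plane}
    {s s' : ℝ} (h : proj (wave a b ε c s) = proj (wave a b ε c s')) :
    (s : UnitAddCircle) = (s' : UnitAddCircle) ∨ ∃ k : ℤ, 4 * idet a b * s = k := by
  obtain ⟨n, hn⟩ := proj_eq_proj_iff.1 h
  set σ := Real.sin (2 * Real.pi * s) with hσ
  set σ' := Real.sin (2 * Real.pi * s') with hσ'
  have h1 : wedge (lat a) (lat n) = (ε * idet a b) * (σ - σ') := by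
    rw [← hn, ← wedge_lat]; simp [wedge, wave]; ring
  have h2 : wedge (lat n) (lat b) = idet a b * (s - s') := by
    rw [← hn, ← wedge_lat]; simp [wedge, wave]; ring
  rw [wedge_lat] at h1 h2
  -- The transverse displacement is an integer of absolute value at most 1/8, so the two sines
  -- agree.
  have hz : idet a n = 0 := by
    have h3 : |(idet a n : ℝ)| < 1 := by
      rw [h1, abs_mul]
      have h4 : |σ - σ'| ≤ 2 := abs_le.2
        ⟨by linarith [Real.neg_one_le_sin (2 * Real.pi * s), Real.sin_le_one (2 * Real.pi * s')],
          by linarith [Real.neg_one_le_sin (2 * Real.pi * s'), Real.sin_le_one (2 * Real.pi * s)]⟩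
      calc |ε * idet a b| * |σ - σ'| ≤ 1 / 16 * 2 := by gcongr
        _ < 1 := by norm_num
    exact Int.abs_lt_one_iff.1 (by exact_mod_cast h3)
  rw [hz, Int.cast_zero] at h1
  have hsin : σ = σ' := sub_eq_zero.1 ((mul_eq_zero.1 h1.symm).resolve_left hε0)
  obtain ⟨k, hk | hk⟩ := Real.sin_eq_sin_iff.1 hsin
  · left
    have hs : s' = s + k := by
      apply mul_left_cancel₀ (Real.two_pi_pos.ne')
      rw [hk]; ring
    have h0 : ((k : ℝ) : UnitAddCircle) = 0 := (AddCircle.coe_eq_zero_iff 1).2 ⟨k, by simp⟩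
    rw [hs, AddCircle.coe_add, h0, add_zero]
  · right
    have hs : s' = k + 1 / 2 - s := by
      apply mul_left_cancel₀ (Real.two_pi_pos.ne')
      rw [hk]; ring
    -- Substituting s' = k + 1/2 - s gives `idet n b = idet a b * (2 * s - k - 1/2)`, which is
    -- solved for `4 * idet a b * s`.
    refine ⟨2 * idet n b + 2 * idet a b * k + idet a b, ?_⟩
    push_cast
    rw [h2, hs]
    ring

theorem exists_transverse_of_idet_ne_zero {a b : Fin 2 → ℤ} (h : idet a b ≠ 0) :
    ∃ α β : SmoothLoop, TransverseDoublePoints α β ∧ winding α.loop = a ∧ winding β.loop = b := by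
  have hD : (idet a b : ℝ) ≠ 0 := by exact_mod_cast h
  have hba : idet b a = -idet a b := by rw [idet, idet]; ring
  set D : ℝ := (idet a b : ℝ) with hDdef
  -- With εD = 1/16 the bound of `wave_selfCrossing` holds. As |D| ≥ 1, also |ε| ≤ 1/16, so the
  -- perturbation has slope at most 1/2 and the curves stay transverse.
  set ε : ℝ := 1 / (16 * D) with hε
  have hεD : ε * D = 1 / 16 := by rw [hε]; field_simp
  have hε1 : |ε| ≤ 1 / 16 := by
    have h1 : (1 : ℝ) ≤ |D| := by
      rw [hDdef]; exact_mod_cast Int.one_le_abs h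
    have h2 : |ε| * |D| = 1 / 16 := by rw [← abs_mul, hεD]; norm_num
    nlinarith [abs_nonneg ε]
  obtain ⟨x, hDx⟩ : ∃ x : ℝ, D * x = 1 / 8 := ⟨1 / (8 * D), by field_simp⟩
  set c : Plane := x • (lat a + lat b) with hc
  obtain ⟨α, hα, hαw⟩ := exists_smoothLoop (contDiff_wave a b ε 0) (wave_add_one a b ε 0)
  obtain ⟨β, hβ, hβw⟩ := exists_smoothLoop (contDiff_wave b a ε c) (wave_add_one b a ε c)
  -- The shift with Dx = 1/8 puts `4 * D * s` and `4 * D * t` at distance at least 1/4 from every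
  -- integer at each crossing, because the sine terms contribute at most 1/4 around a half-integer.
  -- So no crossing occurs at a parameter where a curve may meet itself.
  have hcross : ∀ s t : ℝ, ((s : UnitAddCircle), (t : UnitAddCircle)) ∈ crossings α β →
      (¬ ∃ k : ℤ, 4 * idet a b * s = k) ∧ ¬ ∃ k : ℤ, 4 * idet b a * t = k := by
    intro s t hst
    have h1 : proj (wave a b ε 0 s) = proj (wave b a ε c t) := by
      rw [← hα.2, ← hβ.2]; exact hst
    obtain ⟨n, hn⟩ := proj_eq_proj_iff.1 h1
    have h2 : wedge (lat n) (lat b) =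
        D * s - (ε * D) * Real.sin (2 * Real.pi * t) - D * x := by
      rw [← hn, hDdef, ← wedge_lat]; simp [wedge, wave, hc]; ring
    have h3 : wedge (lat a) (lat n) =
        (ε * D) * Real.sin (2 * Real.pi * s) - D * t - D * x := by
      rw [← hn, hDdef, ← wedge_lat]; simp [wedge, wave, hc]; ring
    rw [wedge_lat, hεD, hDx] at h2 h3
    constructor
    · rintro ⟨k, hk⟩
      have h4 : ((k - 4 * idet n b : ℤ) : ℝ) = Real.sin (2 * Real.pi * t) / 4 + 1 / 2 := by
        push_cast
        rw [h2, ← hk]; ring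
      have h5 : (0 : ℝ) < ((k - 4 * idet n b : ℤ) : ℝ) := by
        rw [h4]; linarith [Real.neg_one_le_sin (2 * Real.pi * t)]
      have h6 : ((k - 4 * idet n b : ℤ) : ℝ) < 1 := by
        rw [h4]; linarith [Real.sin_le_one (2 * Real.pi * t)]
      have h7 : 0 < k - 4 * idet n b := by exact_mod_cast h5
      have h8 : k - 4 * idet n b < 1 := by exact_mod_cast h6
      omega
    · rintro ⟨k, hk⟩
      rw [hba] at hk
      push_cast at hk
      have h4 : ((k - 4 * idet a n : ℤ) : ℝ) = 1 / 2 - Real.sin (2 * Real.pi * s) / 4 := by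
        push_cast
        rw [h3, ← hk]; ring
      have h5 : (0 : ℝ) < ((k - 4 * idet a n : ℤ) : ℝ) := by
        rw [h4]; linarith [Real.sin_le_one (2 * Real.pi * s)]
      have h6 : ((k - 4 * idet a n : ℤ) : ℝ) < 1 := by
        rw [h4]; linarith [Real.neg_one_le_sin (2 * Real.pi * s)]
      have h7 : 0 < k - 4 * idet a n := by exact_mod_cast h5
      have h8 : k - 4 * idet a n < 1 := by exact_mod_cast h6
      omega
  refine ⟨α, β, ⟨?_, ?_, ?_⟩, hαw, hβw⟩
  · rintro ⟨x, y⟩ -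
    obtain ⟨s, rfl⟩ := QuotientAddGroup.mk_surjective x
    obtain ⟨t, rfl⟩ := QuotientAddGroup.mk_surjective y
    change LinearIndependent ℝ ![α.velocity (s : UnitAddCircle), β.velocity (t : UnitAddCircle)]
    rw [← wedge_ne_zero_iff, velocity_coe hα, velocity_coe hβ, deriv_wave, deriv_wave]
    set u := Real.cos (2 * Real.pi * s)
    set v := Real.cos (2 * Real.pi * t)
    have hw : wedge (lat a + (ε * (2 * Real.pi * u)) • lat b)
        (lat b + (ε * (2 * Real.pi * v)) • lat a) =
        D * (1 - (ε * (2 * Real.pi * u)) * (ε * (2 * Real.pi * v))) := by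
      rw [hDdef, ← wedge_lat]; simp [wedge]; ring
    rw [hw]
    refine mul_ne_zero hD (ne_of_gt ?_)
    have hb : ∀ z : ℝ, |z| ≤ 1 → |ε * (2 * Real.pi * z)| ≤ 1 / 2 := fun z hz => by
      rw [abs_mul, abs_mul, abs_of_pos Real.two_pi_pos]
      calc |ε| * (2 * Real.pi * |z|) ≤ 1 / 16 * (2 * 4 * 1) := by
            gcongr
            exact Real.pi_le_four
        _ = 1 / 2 := by norm_num
    have h1 : (ε * (2 * Real.pi * u)) * (ε * (2 * Real.pi * v)) ≤ 1 / 2 * (1 / 2) := by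
      refine (le_abs_self _).trans ?_
      rw [abs_mul]
      exact mul_le_mul (hb u (Real.abs_cos_le_one _)) (hb v (Real.abs_cos_le_one _))
        (abs_nonneg _) (by norm_num)
    linarith
  · rintro ⟨x, y⟩ hxy z hz
    obtain ⟨s, rfl⟩ := QuotientAddGroup.mk_surjective x
    obtain ⟨t, rfl⟩ := QuotientAddGroup.mk_surjective y
    obtain ⟨s', rfl⟩ := QuotientAddGroup.mk_surjective z
    have h1 : proj (wave a b ε 0 s) = proj (wave a b ε 0 s') := by
      rw [← hα.2, ← hα.2]; exact hz.symm
    rcases wave_selfCrossing (by rw [hεD]; norm_num) (by rw [hεD]; norm_num) h1 with h2 | h2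
    · exact h2.symm
    · exact absurd h2 (hcross s t hxy).1
  · rintro ⟨x, y⟩ hxy z hz
    obtain ⟨s, rfl⟩ := QuotientAddGroup.mk_surjective x
    obtain ⟨t, rfl⟩ := QuotientAddGroup.mk_surjective y
    obtain ⟨t', rfl⟩ := QuotientAddGroup.mk_surjective z
    have h1 : proj (wave b a ε c t) = proj (wave b a ε c t') := by
      rw [← hβ.2, ← hβ.2]; exact hz.symm
    have h3 : ε * (idet b a : ℝ) = -(1 / 16) := by
      rw [hba]; push_cast; linarith
    rcases wave_selfCrossing (by rw [h3]; norm_num) (by rw [h3]; norm_num) h1 with h2 | h2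
    · exact h2.symm
    · exact absurd h2 (hcross s t hxy).2

/-- Any two winding vectors are realised by transverse smooth loops. -/
theorem exists_transverse (a b : Fin 2 → ℤ) :
    ∃ α β : SmoothLoop, TransverseDoublePoints α β ∧ winding α.loop = a ∧ winding β.loop = b := by
  by_cases h : idet a b = 0
  · exact exists_transverse_of_idet_eq_zero h
  · exact exists_transverse_of_idet_ne_zero h

/-! ### The bracket on basis elements: uniqueness and Lie identities -/

/-- The basis element of the loop module with winding vector `n`. -/
def windingBasis (n : Fin 2 → ℤ) : LoopModule := Finsupp.single (classEquiv.symm n) 1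

theorem single_eq_smul_windingBasis (x : FreeClass) (c : ℤ) :
    (Finsupp.single x c : LoopModule) = c • windingBasis (classEquiv x) := by
  simp [windingBasis]

theorem single_freeClass (γ : Loop) :
    (Finsupp.single (freeClass γ) 1 : LoopModule) = windingBasis (winding γ) := by
  rw [single_eq_smul_windingBasis, one_smul]; rfl

theorem windingBasis_induction {p : LoopModule → Prop} (h0 : p 0)
    (hadd : ∀ x y, p x → p y → p (x + y)) (hsmul : ∀ (c : ℤ) x, p x → p (c • x))
    (hb : ∀ n, p (windingBasis n)) (x : LoopModule) : p x := by
  induction x using Finsupp.induction_linear with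
  | zero => exact h0
  | add x y hx hy => exact hadd x y hx hy
  | single x c => rw [single_eq_smul_windingBasis]; exact hsmul c _ (hb _)

/-- The Goldman bracket of the torus, on basis elements given by their winding vectors. -/
def bracket (o : Orientation ℝ Plane (Fin 2)) : LoopModule →ₗ[ℤ] LoopModule →ₗ[ℤ] LoopModule :=
  Finsupp.linearCombination ℤ fun x => Finsupp.linearCombination ℤ fun y =>
    (orientationSign o * idet (classEquiv x) (classEquiv y)) •
      windingBasis (classEquiv x + classEquiv y)

theorem bracket_windingBasis (o : Orientation ℝ Plane (Fin 2)) (a b : Fin 2 → ℤ) :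
    bracket o (windingBasis a) (windingBasis b) =
      (orientationSign o * idet a b) • windingBasis (a + b) := by
  simp [bracket, windingBasis]

theorem goldmanSum_eq_smul (o : Orientation ℝ Plane (Fin 2)) {α β : SmoothLoop}
    (h : TransverseDoublePoints α β) :
    goldmanSum o α β = (orientationSign o * idet (winding α.loop) (winding β.loop)) •
      windingBasis (winding α.loop + winding β.loop) := by
  rw [goldmanSum_eq o h, single_eq_smul_windingBasis, Equiv.apply_symm_apply]

theorem isGoldmanBracket_bracket (o : Orientation ℝ Plane (Fin 2)) :
    IsGoldmanBracket o (bracket o) := fun α β h => by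
  rw [goldmanSum_eq_smul o h, single_freeClass, single_freeClass, bracket_windingBasis]

/-- Goldman's formula determines the map on every pair of basis elements, since each pair has
transverse representatives. -/
theorem IsGoldmanBracket.eq_bracket {o : Orientation ℝ Plane (Fin 2)}
    {B : LoopModule →ₗ[ℤ] LoopModule →ₗ[ℤ] LoopModule} (hB : IsGoldmanBracket o B) :
    B = bracket o := by
  refine LinearMap.ext₂ fun x y => ?_
  induction x using windingBasis_induction with
  | h0 => simp
  | hadd x x' hx hx' => simp [hx, hx']
  | hsmul c x hx => simp [hx]
  | hb a =>
    induction y using windingBasis_induction with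
    | h0 => simp
    | hadd y y' hy hy' => simp [hy, hy']
    | hsmul c y hy => simp [hy]
    | hb b =>
      obtain ⟨α, β, h, rfl, rfl⟩ := exists_transverse a b
      rw [← single_freeClass, ← single_freeClass, hB α β h,
        isGoldmanBracket_bracket o α β h]

theorem bracket_skew (o : Orientation ℝ Plane (Fin 2)) (x y : LoopModule) :
    bracket o x y = -bracket o y x := by
  induction x using windingBasis_induction with
  | h0 => simp
  | hadd x x' hx hx' => simp [hx, hx', add_comm]
  | hsmul c x hx => simp [hx]
  | hb a =>
    induction y using windingBasis_induction with
    | h0 => simp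
    | hadd y y' hy hy' => simp [hy, hy', add_comm]
    | hsmul c y hy => simp [hy]
    | hb b =>
      rw [bracket_windingBasis, bracket_windingBasis, add_comm b a, ← neg_smul]
      congr 1
      rw [idet, idet]; ring

/-- Skew-symmetry suffices because the loop module has no 2-torsion. -/
theorem bracket_self (o : Orientation ℝ Plane (Fin 2)) (x : LoopModule) : bracket o x x = 0 :=
  self_eq_neg.1 (bracket_skew o x x)

theorem bracket_jacobi (o : Orientation ℝ Plane (Fin 2)) (x y z : LoopModule) :
    bracket o x (bracket o y z) + bracket o y (bracket o z x) + bracket o z (bracket o x y) = 0 := by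
  have hlin : ∀ {u v w u' v' w' : LoopModule}, u + v + w = 0 → u' + v' + w' = 0 →
      (u + u') + (v + v') + (w + w') = 0 := fun {u v w u' v' w'} h h' => by
    rw [show (u + u') + (v + v') + (w + w') = (u + v + w) + (u' + v' + w') by abel, h, h', add_zero]
  have hsm : ∀ (c : ℤ) {u v w : LoopModule}, u + v + w = 0 → c • u + c • v + c • w = 0 :=
    fun c {u v w} h => by rw [← smul_add, ← smul_add, h, smul_zero]
  induction x using windingBasis_induction with
  | h0 => simp
  | hadd x x' hx hx' => simpa using hlin hx hx'
  | hsmul c x hx => simpa using hsm c hx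
  | hb a =>
    induction y using windingBasis_induction with
    | h0 => simp
    | hadd y y' hy hy' => simpa using hlin hy hy'
    | hsmul c y hy => simpa using hsm c hy
    | hb b =>
      induction z using windingBasis_induction with
      | h0 => simp
      | hadd z z' hz hz' => simpa using hlin hz hz'
      | hsmul k z hz => simpa using hsm k hz
      | hb c =>
        simp only [bracket_windingBasis, map_smul, smul_smul]
        rw [show b + (c + a) = a + (b + c) by abel, show c + (a + b) = a + (b + c) by abel,
          ← add_smul, ← add_smul]
        convert zero_smul ℤ _
        simp only [idet, Pi.add_apply]
        ring

theorem isLieBracket_bracket (o : Orientation ℝ Plane (Fin 2)) : IsLieBracket (bracket o) :=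
  ⟨bracket_self o, bracket_jacobi o⟩

/-! ### The lower central series -/

/-- Here `d` is the gcd of the coordinates, and Bézout coefficients give `e`. -/
theorem exists_primitive {c : Fin 2 → ℤ} (hc : c ≠ 0) :
    ∃ (d : ℤ) (e p : Fin 2 → ℤ), c = d • p ∧ idet e p = 1 := by
  have hd : ((Int.gcd (c 0) (c 1) : ℕ) : ℤ) ≠ 0 := by
    intro h
    have h' : Int.gcd (c 0) (c 1) = 0 := by exact_mod_cast h
    rw [Int.gcd_eq_zero_iff] at h'
    exact hc (by ext i; fin_cases i <;> simp [h'.1, h'.2])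
  obtain ⟨x, hx⟩ := Int.gcd_dvd_left (c 0) (c 1)
  obtain ⟨y, hy⟩ := Int.gcd_dvd_right (c 0) (c 1)
  have hb := Int.gcd_eq_gcd_ab (c 0) (c 1)
  set d : ℤ := ((Int.gcd (c 0) (c 1) : ℕ) : ℤ)
  set u := Int.gcdA (c 0) (c 1)
  set v := Int.gcdB (c 0) (c 1)
  refine ⟨d, ![v, -u], ![x, y], ?_, ?_⟩
  · ext i; fin_cases i <;> simp <;> assumption
  · apply mul_left_cancel₀ hd
    simp only [idet, Matrix.cons_val_zero, Matrix.cons_val_one]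
    rw [hx, hy] at hb
    linear_combination -hb

section LowerCentralSeries

variable (o : Orientation ℝ Plane (Fin 2))

/-- The Goldman Lie algebra of the torus. -/
abbrev Goldman := LieOf (isLieBracket_bracket o)

/-- The basis element with winding vector `n` of the Goldman Lie algebra. -/
def gen (n : Fin 2 → ℤ) : Goldman o := windingBasis n

theorem lie_gen (a b : Fin 2 → ℤ) :
    ⁅gen o a, gen o b⁆ = (orientationSign o * idet a b) • gen o (a + b) :=
  bracket_windingBasis o a b

theorem gen_induction {p : Goldman o → Prop} (h0 : p 0) (hadd : ∀ x y, p x → p y → p (x + y))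
    (hsmul : ∀ (c : ℤ) x, p x → p (c • x)) (hb : ∀ n, p (gen o n)) (x : Goldman o) : p x :=
  windingBasis_induction (p := p) h0 hadd hsmul hb x

theorem gen_ne_zero (n : Fin 2 → ℤ) : gen o n ≠ 0 := by
  intro h
  have h' : (Finsupp.single (classEquiv.symm n) 1 : FreeClass →₀ ℤ) = 0 := h
  simp at h'

/-- The orientation sign squares to 1, so it can be cancelled; membership questions do not depend on
`o`. -/
theorem smul_gen_mem {N : LieIdeal ℤ (Goldman o)} {a : Fin 2 → ℤ} (ha : gen o a ∈ N)
    (b : Fin 2 → ℤ) : idet a b • gen o (a + b) ∈ ⁅(⊤ : LieIdeal ℤ (Goldman o)), N⁆ := by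
  have h1 : ⁅gen o b, gen o a⁆ ∈ ⁅(⊤ : LieIdeal ℤ (Goldman o)), N⁆ :=
    LieSubmodule.lie_mem_lie trivial ha
  have h2 := Submodule.smul_mem (LieSubmodule.toSubmodule _) (-orientationSign o) h1
  rw [lie_gen, smul_smul, add_comm b a] at h2
  have h3 : -orientationSign o * (orientationSign o * idet b a) = idet a b := by
    rw [idet, idet]
    linear_combination (-(b 0 * a 1 - b 1 * a 0)) * orientationSign_mul_self o
  rwa [h3] at h2

theorem lowerCentralSeries_one_le_two :
    LieModule.lowerCentralSeries ℤ (Goldman o) (Goldman o) 1 ≤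
      LieModule.lowerCentralSeries ℤ (Goldman o) (Goldman o) 2 := by
  set N1 := LieModule.lowerCentralSeries ℤ (Goldman o) (Goldman o) 1 with hN1
  set N2 := LieModule.lowerCentralSeries ℤ (Goldman o) (Goldman o) 2 with hN2
  have e1 : N1 = ⁅(⊤ : LieIdeal ℤ (Goldman o)), (⊤ : LieIdeal ℤ (Goldman o))⁆ := by
    rw [hN1, LieModule.lowerCentralSeries_succ, LieModule.lowerCentralSeries_zero]
  have e2 : N2 = ⁅(⊤ : LieIdeal ℤ (Goldman o)), N1⁆ := by
    rw [hN2, LieModule.lowerCentralSeries_succ]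
  have hgen : ∀ a b : Fin 2 → ℤ, ⁅gen o a, gen o b⁆ ∈ N2 := by
    intro a b
    rw [lie_gen]
    by_cases hc : a + b = 0
    · have : idet a b = 0 := by
        rw [eq_neg_of_add_eq_zero_left hc, idet]; simp; ring
      rw [this, mul_zero, zero_smul]
      exact N2.zero_mem
    · obtain ⟨d, e, p, hcd, hep⟩ := exists_primitive hc
      -- `e` is the sum of `e - p` and `p`, whose determinant is 1.
      have he : gen o e ∈ N1 := by
        have h1 := smul_gen_mem o (N := ⊤) (a := e - p) trivial p
        have h2 : idet (e - p) p = 1 := by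
          rw [← hep]; simp only [idet, Pi.sub_apply]; ring
        rwa [h2, one_smul, sub_add_cancel, ← e1] at h1
      have h3 := smul_gen_mem o he (a + b - e)
      rw [← e2, add_sub_cancel] at h3
      have h4 : idet e (a + b - e) = d := by
        rw [hcd]
        simp only [idet, Pi.sub_apply, Pi.smul_apply, smul_eq_mul] at hep ⊢
        linear_combination d * hep
      rw [h4] at h3
      -- The divisibility that makes the argument work over ℤ: the coefficient of the bracket is a
      -- multiple of `d`, and `d • gen o (a + b)` is already in `N2`.
      have h5 : idet a b = idet a p * d := by
        have h6 : idet a b = idet a (a + b) := by simp only [idet, Pi.add_apply]; ring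
        rw [h6, hcd]
        simp only [idet, Pi.smul_apply, smul_eq_mul]; ring
      rw [h5, ← mul_assoc, mul_smul]
      exact Submodule.smul_mem (LieSubmodule.toSubmodule N2) _ h3
  rw [e1, LieSubmodule.lie_le_iff]
  intro x _ y _
  induction x using gen_induction with
  | h0 => rw [zero_lie]; exact N2.zero_mem
  | hadd u v hu hv => rw [add_lie]; exact N2.add_mem (hu trivial) (hv trivial)
  | hsmul c u hu =>
    rw [smul_lie]; exact Submodule.smul_mem (LieSubmodule.toSubmodule N2) c (hu trivial)
  | hb a =>
    induction y using gen_induction with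
    | h0 => rw [lie_zero]; exact N2.zero_mem
    | hadd u v hu hv => rw [lie_add]; exact N2.add_mem (hu trivial) (hv trivial)
    | hsmul c u hu =>
      rw [lie_smul]; exact Submodule.smul_mem (LieSubmodule.toSubmodule N2) c (hu trivial)
    | hb b => exact hgen a b

theorem lowerCentralSeries_eq_one {k : ℕ} (hk : 1 ≤ k) :
    LieModule.lowerCentralSeries ℤ (Goldman o) (Goldman o) k =
      LieModule.lowerCentralSeries ℤ (Goldman o) (Goldman o) 1 := by
  induction k, hk using Nat.le_induction with
  | base => rfl
  | succ k _ ih =>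
    rw [LieModule.lowerCentralSeries_succ, ih]
    refine le_antisymm (LieSubmodule.lie_le_right _ _) ((lowerCentralSeries_one_le_two o).trans ?_)
    rw [LieModule.lowerCentralSeries_succ]

theorem lowerCentralSeries_one_ne_bot :
    LieModule.lowerCentralSeries ℤ (Goldman o) (Goldman o) 1 ≠ ⊥ := by
  intro h
  have h1 := smul_gen_mem o (N := ⊤) (a := ![1, 0]) trivial ![0, 1]
  have h2 : idet ![1, 0] ![0, 1] = 1 := by simp [idet]
  rw [LieModule.lowerCentralSeries_succ, LieModule.lowerCentralSeries_zero] at h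
  rw [h, h2, one_smul] at h1
  exact gen_ne_zero o _ ((LieSubmodule.mem_bot _).1 h1)

theorem not_isNilpotent : ¬ LieRing.IsNilpotent (Goldman o) := by
  rintro ⟨k, hk⟩
  refine lowerCentralSeries_one_ne_bot o (le_bot_iff.1 ?_)
  -- The index `k + 1` covers the case `k = 0`, where the series has not yet stabilised.
  rw [← lowerCentralSeries_eq_one o (k := k + 1) (by omega), ← hk]
  exact LieModule.antitone_lowerCentralSeries ℤ _ _ (Nat.le_succ k)

end LowerCentralSeries

end TorusGoldman

end

theorem mainTheorem7 (o : Orientation ℝ TorusGoldman.Plane (Fin 2)) :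
    (∃! B : TorusGoldman.LoopModule →ₗ[ℤ] TorusGoldman.LoopModule →ₗ[ℤ] TorusGoldman.LoopModule,
      TorusGoldman.IsGoldmanBracket o B) ∧
    ∀ B : TorusGoldman.LoopModule →ₗ[ℤ] TorusGoldman.LoopModule →ₗ[ℤ] TorusGoldman.LoopModule,
      TorusGoldman.IsGoldmanBracket o B →
      ∃ h : TorusGoldman.IsLieBracket B,
        ¬ LieRing.IsNilpotent (TorusGoldman.LieOf h) ∧
        ∃ I : LieIdeal ℤ (TorusGoldman.LieOf h), I ≠ ⊥ ∧
          ∀ k : ℕ, 1 ≤ k →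
            LieModule.lowerCentralSeries ℤ (TorusGoldman.LieOf h) (TorusGoldman.LieOf h) k = I := by
  refine ⟨⟨TorusGoldman.bracket o, TorusGoldman.isGoldmanBracket_bracket o,
    fun B hB => hB.eq_bracket⟩, fun B hB => ?_⟩
  obtain rfl := hB.eq_bracket
  exact ⟨TorusGoldman.isLieBracket_bracket o, TorusGoldman.not_isNilpotent o, _,
    TorusGoldman.lowerCentralSeries_one_ne_bot o,
    fun k hk => TorusGoldman.lowerCentralSeries_eq_one o hk⟩
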